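/- **Conventions.** A vertex operator algebra $(V,Y,\mathbf 1,\omega)$ over $\mathbb C$ is $\mathbb Z$-graded, $V=\coprod_{n\in\mathbb Z}V_{(n)}$, with $\dim V_{(n)}<\infty$ and $V_{(n)}=0$ for $n$ sufficiently small, and satisfies the usual axioms (lower truncation, vacuum and creation properties, Jacobi identity, Virasoro relations for $L(n)=\omega_{n+1}$, $L(0)v=nv$ on $V_{(n)}$, $L(-1)$-derivative property). A $V$-module is $\mathbb C$-graded, $W=\coprod_{n\in\mathbb C}W_{(n)}$, with $\dim W_{(n)}<\infty$, $W_{(n)}=0$ for $n$ whose real part is sufficiently small, and satisfies the corresponding axioms. Put $\delta(x)=\sum_{n\in\mathbb Z}x^n$; binomial powers are expanded in nonnegative integral powers of the second summand. For a module $(W_1,Y_1)$ put $Y_1^*(v,x)=Y_1(e^{xL(1)}(-x^{-2})^{L(0)}v,x^{-1})$. Let $V$ be a vertex operator algebra, let $(W_1,Y_1)$ and $(W_2,Y_2)$ be $V$-modules, and let $z\in\mathbb C^\times$. For $v\in V$ put $Y_t(v,x)=\sum_{n\in\mathbb Z}(v\otimes t^n)x^{-n-1}$. For $\lambda\in(W_1\otimes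 W_2)^*$, $w_{(1)}\in W_1$ and $w_{(2)}\in W_2$, define $$\Bigl(\tau_{Q(z)}\Bigl(z^{-1}\delta\Bigl(\tfrac{x_1-x_0}{z}\Bigr)Y_t(v,x_0)\Bigr)\lambda\Bigr)(w_{(1)}\otimes w_{(2)})=x_0^{-1}\delta\Bigl(\tfrac{x_1-z}{x_0}\Bigr)\lambda(Y_1^*(v,x_1)w_{(1)}\otimes w_{(2)})-x_0^{-1}\delta\Bigl(\tfrac{z-x_1}{-x_0}\Bigr)\lambda(w_{(1)}\otimes Y_2(v,x_1)w_{(2)}),$$ and let $Y'_{Q(z)}(v,x_0)=\sum_{n\in\mathbb Z}\tau_{Q(z)}(v\otimes t^n)x_0^{-n-1}$ be the residue of this in $x_1$ (the coefficient of $x_1^{-1}$), as a family of operators on $(W_1\otimes W_2)^*$. An element $\lambda\in(W_1\otimes W_2)^*$ satisfies the *compatibility condition* if (a) for every $v\in V$, $\tau_{Q(z)}(v\otimes t^n)\lambda=0$ for all sufficiently large $n$, and (b) for every $v\in V$, $\ \tau_{Q(z)}\bigl(z^{-1}\delta(\tfrac{x_1-x_0}{z})Y_t(v,x_0)\bigr)\lambda=z^{-1}\delta(\tfrac{x_1-x_0}{z})\,Y'_{Q(z)}(v,x_0)\lambda$.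 Call eigenvectors of $L'_{Q(z)}(0)=\tau_{Q(z)}(\omega\otimes t)$ in $(W_1\otimes W_2)^*$ weight vectors, their weights being the eigenvalues. The element $\lambda$ satisfies the *local grading-restriction condition* if (a) $\lambda$ is a finite sum of weight vectors, and (b) if $W_\lambda$ denotes the smallest subspace of $(W_1\otimes W_2)^*$ that contains $\lambda$ and is stable under all the operators $\tau_{Q(z)}(v\otimes t^n)$ ($v\in V$, $n\in\mathbb Z$), then the weight spaces of $W_\lambda$ satisfy $\dim (W_\lambda)_{(n)}<\infty$ for all $n\in\mathbb C$, and $(W_\lambda)_{(n)}=0$ for $n$ whose real part is sufficiently small. **Proposition 6.2.** The elements of $(W_1\otimes W_2)^*$ satisfying the compatibility condition form a subspace, and this subspace is stable under the operators $\tau_{Q(z)}(v\otimes t^n)$ for all $v\in V$ and $n\in\mathbb Z$, that is, under the components of $Y'_{Q(z)}(v,x)$. Likewise, the elements satisfying the local grading-restriction condition form a subspace, and this subspace is stable under the operators $\tau_{Q(z)}(v\otimes t^n)$ for all $v\in V$ and $n\in\mathbb Z$. -/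

import Mathlib

open scoped TensorProduct

noncomputable section

/-! ### Vertex operators and their modes -/

/-- For a linear map `v ↦ Y(v, x) = ∑ₙ vₙ x^{-n-1}` from `V` to the vertex operators on `W`
(so `Y(v, x) w ∈ W((x))`), the component `vₙ`, i.e. the coefficient of `x^{-n-1}`. -/
def vertexMode {V W : Type*} [AddCommGroup V] [Module ℂ V] [AddCommGroup W] [Module ℂ W]
    (Y : V →ₗ[ℂ] VertexOperator ℂ W) (v : V) (n : ℤ) : Module.End ℂ W :=
  VertexOperator.ncoeff (Y v) n

/-- The Jacobi identity
`x₀⁻¹ δ((x₁-x₂)/x₀) Y_W(u,x₁) Y_W(v,x₂) - x₀⁻¹ δ((x₂-x₁)/(-x₀)) Y_W(v,x₂) Y_W(u,x₁)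
  = x₂⁻¹ δ((x₁-x₀)/x₂) Y_W(Y(u,x₀)v, x₂)`,
written as the equality of the coefficients of `x₀^{-l-1} x₁^{-m-1} x₂^{-n-1}` applied to each `w`.
All the sums are finite because of the lower truncation condition. -/
def JacobiIdentity {V W : Type*} [AddCommGroup V] [Module ℂ V] [AddCommGroup W] [Module ℂ W]
    (Y : V →ₗ[ℂ] VertexOperator ℂ V) (YW : V →ₗ[ℂ] VertexOperator ℂ W) : Prop :=
  ∀ (u v : V) (w : W) (l m n : ℤ),
    (∑ᶠ i : ℕ, ((-1 : ℂ) ^ i * (Ring.choose l i : ℂ)) •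
        vertexMode YW u (m + l - i) (vertexMode YW v (n + i) w)) -
      (∑ᶠ i : ℕ, ((-1 : ℂ) ^ l * (-1 : ℂ) ^ i * (Ring.choose l i : ℂ)) •
        vertexMode YW v (n + l - i) (vertexMode YW u (m + i) w)) =
      ∑ᶠ i : ℕ, (Ring.choose m i : ℂ) •
        vertexMode YW (vertexMode Y u (l + i) v) (m + n - i) w

/-- The Virasoro algebra relations with central charge `c`. -/
def VirasoroRelations {W : Type*} [AddCommGroup W] [Module ℂ W]
    (L : ℤ → Module.End ℂ W) (c : ℂ) : Prop :=
  ∀ m n : ℤ, L m * L n - L n * L m =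
    ((m : ℂ) - n) • L (m + n) +
      (if m + n = 0 then c / 12 * ((m : ℂ) ^ 3 - m) else 0) • (1 : Module.End ℂ W)

/-- A vertex operator algebra over `ℂ`. The lower truncation condition (`uₙ v = 0` for large `n`)
is part of `VertexOperator`. -/
structure VertexOperatorAlgebra (V : Type*) [AddCommGroup V] [Module ℂ V] where
  /-- the homogeneous subspace of weight `n` -/
  grade : ℤ → Submodule ℂ V
  isInternal : DirectSum.IsInternal grade
  finiteDimensional_grade : ∀ n, FiniteDimensional ℂ (grade n)
  grade_eq_bot : ∃ N : ℤ, ∀ n < N, grade n = ⊥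
  /-- the vertex operator map `v ↦ Y(v, x)` -/
  Y : V →ₗ[ℂ] VertexOperator ℂ V
  vacuum : V
  /-- the Virasoro element `ω` -/
  conformal : V
  vacuum_mem : vacuum ∈ grade 0
  conformal_mem : conformal ∈ grade 2
  /-- `Y(1, x) = 1` -/
  vacuum_mode : ∀ n : ℤ, vertexMode Y vacuum n = if n = -1 then 1 else 0
  /-- `Y(v, x) 1 ∈ V[[x]]` -/
  creation_regular : ∀ (v : V) (n : ℤ), 0 ≤ n → vertexMode Y v n vacuum = 0
  /-- the constant term of `Y(v, x) 1` is `v` -/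
  creation : ∀ v : V, vertexMode Y v (-1) vacuum = v
  jacobi : JacobiIdentity Y Y
  /-- the rank (central charge) of the algebra -/
  rank : ℂ
  virasoro : VirasoroRelations (fun n => vertexMode Y conformal (n + 1)) rank
  /-- `L(0) v = (wt v) v` -/
  L_zero : ∀ (n : ℤ), ∀ v ∈ grade n, vertexMode Y conformal 1 v = (n : ℂ) • v
  /-- `(d/dx) Y(v, x) = Y(L(-1) v, x)` -/
  L_neg_one_derivative : ∀ (v : V) (n : ℤ),
    vertexMode Y (vertexMode Y conformal 0 v) n = (-(n : ℂ)) • vertexMode Y v (n - 1)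

/-- A module for a vertex operator algebra; the grading is by complex weights. The lower
truncation condition (`vₙ w = 0` for large `n`) is part of `VertexOperator`. -/
structure VertexOperatorModule {V : Type*} [AddCommGroup V] [Module ℂ V]
    (A : VertexOperatorAlgebra V) (W : Type*) [AddCommGroup W] [Module ℂ W] where
  /-- the homogeneous subspace of weight `n` -/
  grade : ℂ → Submodule ℂ W
  isInternal : DirectSum.IsInternal grade
  finiteDimensional_grade : ∀ n, FiniteDimensional ℂ (grade n)
  /-- the weight spaces vanish for weights whose real part is sufficiently small -/
  grade_eq_bot : ∃ N : ℝ, ∀ n : ℂ, n.re < N → grade n = ⊥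
  /-- the vertex operator map `v ↦ Y_W(v, x)` -/
  Y : V →ₗ[ℂ] VertexOperator ℂ W
  vacuum_mode : ∀ n : ℤ, vertexMode Y A.vacuum n = if n = -1 then 1 else 0
  jacobi : JacobiIdentity A.Y Y
  virasoro : VirasoroRelations (fun n => vertexMode Y A.conformal (n + 1)) A.rank
  L_zero : ∀ (n : ℂ), ∀ w ∈ grade n, vertexMode Y A.conformal 1 w = n • w
  L_neg_one_derivative : ∀ (v : V) (n : ℤ),
    vertexMode Y (vertexMode A.Y A.conformal 0 v) n = (-(n : ℂ)) • vertexMode Y v (n - 1)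

section Modes

variable {V W : Type*} [AddCommGroup V] [Module ℂ V] [AddCommGroup W] [Module ℂ W]

/-- The lower truncation condition for vertex operators. -/
theorem vertexMode_truncation (Y : V →ₗ[ℂ] VertexOperator ℂ W) (v : V) (w : W) :
    ∃ N : ℤ, ∀ n : ℤ, N ≤ n → vertexMode Y v n w = 0 := by
  obtain ⟨b, hb⟩ : BddBelow (Function.support ((HahnModule.of ℂ).symm ((Y v) w)).coeff) := by
    rcases Set.eq_empty_or_nonempty (Function.support ((HahnModule.of ℂ).symm ((Y v) w)).coeff)
      with he | he
    · rw [he]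
      exact bddBelow_empty
    · have hwf := (HVertexOperator.coeff_isPWOsupport (Y v) w).isWF
      exact ⟨hwf.min he, fun a ha => hwf.min_le he ha⟩
  refine ⟨-b, fun n hn => ?_⟩
  by_contra hne
  have : -n - 1 ∈ Function.support ((HahnModule.of ℂ).symm ((Y v) w)).coeff := hne
  have := hb this
  omega

theorem vertexMode_zero_left (Y : V →ₗ[ℂ] VertexOperator ℂ W) (n : ℤ) :
    vertexMode Y 0 n = 0 := by
  simp [vertexMode]

/-- The sum of a pointwise finite family of endomorphisms. -/
def pointwiseSum (f : ℕ → Module.End ℂ W)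
    (hf : ∀ w, (Function.support fun i => f i w).Finite) : Module.End ℂ W where
  toFun w := ∑ᶠ i : ℕ, f i w
  map_add' a b := by
    simp only [map_add]
    exact finsum_add_distrib (hf a) (hf b)
  map_smul' c a := by
    simp only [map_smul, RingHom.id_apply]
    exact (smul_finsum' c (hf a)).symm

end Modes

namespace VertexOperatorAlgebra

variable {V : Type*} [AddCommGroup V] [Module ℂ V] (A : VertexOperatorAlgebra V)

/-- The homogeneous component of weight `h` of a vector. -/
def component (h : ℤ) (v : V) : V :=
  letI := A.isInternal.chooseDecomposition
  (DirectSum.decompose A.grade v h : V)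

/-- The operator `L(1) = ω₂` on `V`. -/
def LOne : Module.End ℂ V := vertexMode A.Y A.conformal 2

theorem component_mem (h : ℤ) (v : V) : A.component h v ∈ A.grade h := by
  unfold component
  exact SetLike.coe_mem _

theorem finite_component (v : V) : {h : ℤ | A.component h v ≠ 0}.Finite := by
  let _ := A.isInternal.chooseDecomposition
  refine (DFinsupp.finite_support (DirectSum.decompose A.grade v)).subset ?_
  intro h hh hz
  exact hh (by simp [component, hz])

theorem mem_grade_of_L_zero (n : ℤ) (v : V)
    (hv : vertexMode A.Y A.conformal 1 v = (n : ℂ) • v) : v ∈ A.grade n := by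
  let _ := A.isInternal.chooseDecomposition
  have key : ∀ x : V, ∀ k : ℤ,
      A.component k (vertexMode A.Y A.conformal 1 x) = (k : ℂ) • A.component k x := by
    intro x k
    induction x using DirectSum.Decomposition.inductionOn A.grade with
    | zero => simp [component]
    | @homogeneous i m =>
      rw [A.L_zero i m m.2]
      by_cases hik : i = k
      · subst hik
        simp [component, DirectSum.smul_apply]
      · simp [component, DirectSum.smul_apply, DirectSum.of_eq_of_ne _ _ _ (Ne.symm hik)]
    | add a b ha hb =>
      simp only [component, map_add, DirectSum.decompose_add, DirectSum.add_apply,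
        Submodule.coe_add, smul_add] at ha hb ⊢
      rw [ha, hb]
  have hz : ∀ k, k ≠ n → A.component k v = 0 := by
    intro k hk
    have h1 := key v k
    rw [hv] at h1
    have h2 : A.component k ((n : ℂ) • v) = (n : ℂ) • A.component k v := by
      simp [component, DirectSum.smul_apply]
    rw [h2] at h1
    have h3 : ((n : ℂ) - k) • A.component k v = 0 := by rw [sub_smul, h1, sub_self]
    rcases smul_eq_zero.1 h3 with h4 | h4
    · exact absurd (by exact_mod_cast (sub_eq_zero.1 h4).symm) hk
    · exact h4
  have hs : v = A.component n v := by
    apply (DirectSum.decompose A.grade).injective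
    ext k
    by_cases hk : k = n
    · subst hk
      simp [component]
    · have := hz k hk
      simp only [component] at this ⊢
      rw [this, DirectSum.decompose_coe, DirectSum.of_eq_of_ne _ _ _ hk]
      rfl
  rw [hs]
  exact A.component_mem n v

/-- `L(1)` lowers the weight by one. -/
theorem LOne_mem (n : ℤ) (v : V) (hv : v ∈ A.grade n) : A.LOne v ∈ A.grade (n - 1) := by
  apply A.mem_grade_of_L_zero
  have h := LinearMap.congr_fun (A.virasoro 0 1) v
  simp only [zero_add, LinearMap.sub_apply, Module.End.mul_apply, LinearMap.add_apply,
    LinearMap.smul_apply] at h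
  rw [A.L_zero n v hv] at h
  norm_num at h
  unfold LOne
  rw [sub_eq_iff_eq_add] at h
  rw [h]
  push_cast
  module

/-- `L(1)` is locally nilpotent on homogeneous vectors. -/
theorem LOne_pow_eq_zero (n : ℤ) (v : V) (hv : v ∈ A.grade n) :
    ∃ J : ℕ, ∀ j : ℕ, J ≤ j → (A.LOne ^ j) v = 0 := by
  have hm : ∀ j : ℕ, (A.LOne ^ j) v ∈ A.grade (n - j) := by
    intro j
    induction j with
    | zero => simpa using hv
    | succ j ih =>
      rw [pow_succ', Module.End.mul_apply]
      have := A.LOne_mem _ _ ih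
      convert this using 2
      push_cast
      ring
  obtain ⟨N, hN⟩ := A.grade_eq_bot
  refine ⟨(n - N + 1).toNat, fun j hj => ?_⟩
  have := hm j
  rw [hN _ (by omega)] at this
  simpa using this

end VertexOperatorAlgebra

namespace VertexOperatorModule

variable {V : Type*} [AddCommGroup V] [Module ℂ V] {A : VertexOperatorAlgebra V}
variable {W : Type*} [AddCommGroup W] [Module ℂ W] (M : VertexOperatorModule A W)

/-- The coefficient of `x^{-n-1}` in the opposite vertex operator
`Y*(v, x) = Y(e^{xL(1)} (-x⁻²)^{L(0)} v, x⁻¹)`. On the component `v_h` of weight `h` of `v`,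
`e^{xL(1)} (-x⁻²)^{L(0)} v_h = ∑ⱼ (-1)^h x^{j-2h} L(1)^j v_h / j!`. -/
def oppMode (v : V) (n : ℤ) : Module.End ℂ W :=
  ∑ᶠ h : ℤ, ∑ᶠ j : ℕ, ((-1 : ℂ) ^ h / (j.factorial : ℂ)) •
    vertexMode M.Y ((A.LOne ^ j) (A.component h v)) (2 * h - j - n - 2)

theorem oppMode_truncation (v : V) (w : W) :
    ∃ N : ℤ, ∀ n : ℤ, n ≤ N → M.oppMode v n w = 0 := by
  classical
  have hJ : ∀ h : ℤ, ∃ J : ℕ, ∀ j : ℕ, J ≤ j → (A.LOne ^ j) (A.component h v) = 0 :=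
    fun h => A.LOne_pow_eq_zero h _ (A.component_mem h v)
  choose J hJ using hJ
  have hN : ∀ (h : ℤ) (j : ℕ), ∃ N : ℤ, ∀ n : ℤ, N ≤ n →
      vertexMode M.Y ((A.LOne ^ j) (A.component h v)) n w = 0 :=
    fun h j => vertexMode_truncation M.Y _ w
  choose N hN using hN
  set H : Finset ℤ := (A.finite_component v).toFinset with hH
  have hs : ∀ n : ℤ, M.oppMode v n = ∑ h ∈ H, ∑ j ∈ Finset.range (J h),
      ((-1 : ℂ) ^ h / (j.factorial : ℂ)) •
        vertexMode M.Y ((A.LOne ^ j) (A.component h v)) (2 * h - j - n - 2) := by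
    intro n
    unfold oppMode
    rw [finsum_eq_sum_of_support_subset (s := H)]
    · refine Finset.sum_congr rfl fun h _ => ?_
      rw [finsum_eq_sum_of_support_subset (s := Finset.range (J h))]
      intro j hj
      by_contra hlt
      apply hj
      have : J h ≤ j := by simpa using hlt
      simp [hJ h j this, vertexMode_zero_left]
    · intro h hh
      by_contra hn
      apply hh
      have : A.component h v = 0 := by
        by_contra hc
        exact hn (by simpa [hH] using hc)
      simp [this, vertexMode_zero_left]
  obtain ⟨B, hB⟩ : ∃ B : ℤ, ∀ h ∈ H, ∀ j ∈ Finset.range (J h), N h j - (2 * h - j - 2) ≤ B := by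
    obtain ⟨B, hB⟩ := ((H.sigma fun h => Finset.range (J h)).image
      fun p => N p.1 p.2 - (2 * p.1 - p.2 - 2)).bddAbove
    refine ⟨B, fun h hh j hj => hB ?_⟩
    simp only [Finset.coe_image, Set.mem_image]
    exact ⟨⟨h, j⟩, by simpa using ⟨by simpa using hh, by simpa using hj⟩, rfl⟩
  refine ⟨-B, fun n hn => ?_⟩
  rw [hs n, LinearMap.sum_apply]
  refine Finset.sum_eq_zero fun h hh => ?_
  rw [LinearMap.sum_apply]
  refine Finset.sum_eq_zero fun j hj => ?_
  rw [LinearMap.smul_apply, hN h j _ (by have := hB h hh j hj; omega), smul_zero]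

/-- The coefficient of `x₀^{-k-1} x₁^{-m-1}` in `x₀⁻¹ δ((x₁-z)/x₀) Y*(v, x₁)`, where `(x₁-z)^k` is
expanded in nonnegative powers of `z`. -/
def oppDelta (z : ℂ) (v : V) (k m : ℤ) : Module.End ℂ W :=
  pointwiseSum (fun i => ((Ring.choose k i : ℂ) * (-z) ^ i) • M.oppMode v (m + k - i)) (by
    intro w
    obtain ⟨N, hN⟩ := M.oppMode_truncation v w
    refine (Set.finite_Iio (m + k - N).toNat).subset fun i hi => ?_
    by_contra hlt
    apply hi
    simp only [Set.mem_Iio, not_lt] at hlt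
    simp [hN (m + k - i) (by omega)])

/-- The coefficient of `x₀^{-k-1} x₁^{-m-1}` in `x₀⁻¹ δ((z-x₁)/(-x₀)) Y(v, x₁)`, where
`(-z+x₁)^k` is expanded in nonnegative powers of `x₁`. -/
def delta (z : ℂ) (v : V) (k m : ℤ) : Module.End ℂ W :=
  pointwiseSum (fun i => ((Ring.choose k i : ℂ) * (-z) ^ (k - i)) • vertexMode M.Y v (m + i)) (by
    intro w
    obtain ⟨N, hN⟩ := vertexMode_truncation M.Y v w
    refine (Set.finite_Iio (N - m).toNat).subset fun i hi => ?_
    by_contra hlt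
    apply hi
    simp only [Set.mem_Iio, not_lt] at hlt
    simp [hN (m + i) (by omega)])

end VertexOperatorModule

/-! ### The action on `(W₁ ⊗ W₂)*` -/

section Qz

variable {V : Type*} [AddCommGroup V] [Module ℂ V] {A : VertexOperatorAlgebra V}
variable {W₁ : Type*} [AddCommGroup W₁] [Module ℂ W₁] (M₁ : VertexOperatorModule A W₁)
variable {W₂ : Type*} [AddCommGroup W₂] [Module ℂ W₂] (M₂ : VertexOperatorModule A W₂)

/-- The operator `τ_{Q(z)}(v ⊗ t^k (z+t)^m)` on `(W₁ ⊗ W₂)*`, with `(z+t)^m` expanded in nonnegative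
powers of `t`. Equivalently, the coefficient of `x₀^{-k-1} x₁^{-m-1}` in
`τ_{Q(z)}(z⁻¹ δ((x₁-x₀)/z) Y_t(v, x₀))`, where `Y_t(v, x) = ∑ₙ (v ⊗ t^n) x^{-n-1}`. It is given by
`(τ_{Q(z)}(z⁻¹ δ((x₁-x₀)/z) Y_t(v, x₀)) l)(w₁ ⊗ w₂)
  = x₀⁻¹ δ((x₁-z)/x₀) l(Y₁*(v, x₁) w₁ ⊗ w₂) - x₀⁻¹ δ((z-x₁)/(-x₀)) l(w₁ ⊗ Y₂(v, x₁) w₂)`. -/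
def tauQ (z : ℂ) (v : V) (k m : ℤ) : Module.End ℂ (Module.Dual ℂ (W₁ ⊗[ℂ] W₂)) :=
  ((M₁.oppDelta z v k m).rTensor W₂ - (M₂.delta z v k m).lTensor W₁).dualMap

/-- The component `τ_{Q(z)}(v ⊗ t^n)` of `Y'_{Q(z)}(v, x) = ∑ₙ τ_{Q(z)}(v ⊗ t^n) x^{-n-1}`; it is
the residue in `x₁` of the series defining `tauQ`. -/
def YQ (z : ℂ) (v : V) (n : ℤ) : Module.End ℂ (Module.Dual ℂ (W₁ ⊗[ℂ] W₂)) :=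
  tauQ M₁ M₂ z v n 0

/-- The lower truncation condition: for each `v`, the series `Y'_{Q(z)}(v, x) l` has only finitely
many negative powers of `x`. -/
def LowerTruncationCondition (z : ℂ) (l : Module.Dual ℂ (W₁ ⊗[ℂ] W₂)) : Prop :=
  ∀ v : V, ∃ N : ℤ, ∀ n : ℤ, N ≤ n → YQ M₁ M₂ z v n l = 0

/-- The compatibility condition: the lower truncation condition, and for all `v`,
`τ_{Q(z)}(z⁻¹ δ((x₁-x₀)/z) Y_t(v, x₀)) l = z⁻¹ δ((x₁-x₀)/z) Y'_{Q(z)}(v, x₀) l`,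
written as the equality of the coefficients of `x₀^{-k-1} x₁^{-m-1}`; here
`z⁻¹ δ((x₁-x₀)/z) = x₁⁻¹ δ((z+x₀)/x₁) = ∑ₘ (z+x₀)^m x₁^{-m-1}`, expanded in nonnegative
powers of `x₀`. The sum is finite by the lower truncation condition. -/
def CompatibilityCondition (z : ℂ) (l : Module.Dual ℂ (W₁ ⊗[ℂ] W₂)) : Prop :=
  LowerTruncationCondition M₁ M₂ z l ∧
    ∀ (v : V) (k m : ℤ), tauQ M₁ M₂ z v k m l =
      ∑ᶠ i : ℕ, ((Ring.choose m i : ℂ) * z ^ (m - i)) • YQ M₁ M₂ z v (k + i) l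

/-- The weight space of weight `n` in `(W₁ ⊗ W₂)*`: the eigenspace of
`L'_{Q(z)}(0) = τ_{Q(z)}(ω ⊗ t)`. -/
def weightSpaceQ (z : ℂ) (n : ℂ) : Submodule ℂ (Module.Dual ℂ (W₁ ⊗[ℂ] W₂)) :=
  Module.End.eigenspace (YQ M₁ M₂ z A.conformal 1) n

/-- The smallest subspace of `(W₁ ⊗ W₂)*` that contains `l` and is stable under the component
operators `τ_{Q(z)}(v ⊗ t^n)`. -/
def generatedQ (z : ℂ) (l : Module.Dual ℂ (W₁ ⊗[ℂ] W₂)) :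
    Submodule ℂ (Module.Dual ℂ (W₁ ⊗[ℂ] W₂)) :=
  sInf {S | l ∈ S ∧ ∀ (v : V) (n : ℤ), ∀ μ ∈ S, YQ M₁ M₂ z v n μ ∈ S}

/-- The local grading-restriction condition: `l` is a finite sum of weight vectors, and the weight
spaces of the subspace generated by `l` are finite-dimensional and vanish for weights whose real
part is sufficiently small. -/
def LocalGradingRestrictionCondition (z : ℂ) (l : Module.Dual ℂ (W₁ ⊗[ℂ] W₂)) : Prop :=
  (l ∈ ⨆ n : ℂ, weightSpaceQ M₁ M₂ z n) ∧
    (∀ n : ℂ, FiniteDimensional ℂ ↥(generatedQ M₁ M₂ z l ⊓ weightSpaceQ M₁ M₂ z n)) ∧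
    ∃ N : ℝ, ∀ n : ℂ, n.re < N → generatedQ M₁ M₂ z l ⊓ weightSpaceQ M₁ M₂ z n = ⊥

end Qz

end

/-! Everything follows from one commutator formula. Formally `tauQ z v k m` is the action of `v ⊗ f`
with `f = t^k (z+t)^m`, and `YQ z v n` that of `v ⊗ t^n`. The brackets are those of the loop
algebra: `[u ⊗ f, v ⊗ g]` is the sum over `s` of `u_s v ⊗ (f^(s)/s!) g`, where Leibniz splits
`f^(s)/s!` over pairs `p.1 + p.2 = s` (`tauQ_commutator`).

On `W₂` this is the commutator formula for ordinary modes, summed against the binomial coefficients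
of the delta function (`delta_commutator`). On `W₁` it needs the same formula, with the opposite
sign, for the modes of `Y₁*` (`oppMode_commutator`); this comes from conjugating vertex operators by
`exp(x L(1))` (`LOneDiv_mode`). Passing to the dual reverses commutators, and the signs then agree.

Compatibility: commuting `YQ z v n` past both sides of the condition leaves correction terms that
involve only the compatibility of `l` for the vectors `u_s v`; they match by a binomial identity.

Local grading restriction: bracketing with the conformal vector shows that a homogeneous `v` shifts
weights by a constant, so the subspace generated by a sum of weight vectors lies in the sum of the
weight spaces. An `L'(0)`-stable subspace of that sum is the sum of its own weight spaces. Hence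
weight spaces of `W_l + W_l'` are sums of those of `W_l` and `W_l'`, which gives closure under
addition. Scalars and the action stay inside `W_l`, whose subspaces inherit both restrictions. -/

open Finset.HasAntidiagonal (antidiagonal mem_antidiagonal)

/-! ### Finite double sums arranged by total degree -/

section Sums

variable {E : Type*} [AddCommMonoid E]

/-- The support lies in the triangle `i + j < B`, so triangle and square give the same sum. Products
of modes depend on their indices through `i + j`, which is why this arrangement is wanted. -/
theorem sum_range_sum_antidiagonal_eq (F : ℕ → ℕ → E) (B : ℕ)
    (h : ∀ i j, B ≤ i + j → F i j = 0) :
    ∑ N ∈ Finset.range B, ∑ p ∈ antidiagonal N, F p.1 p.2 =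
      ∑ i ∈ Finset.range B, ∑ j ∈ Finset.range B, F i j := by
  rw [Finset.sum_sigma', ← Finset.sum_product', ← Finset.sum_filter_of_ne (s := _ ×ˢ _)
    (p := fun q : ℕ × ℕ => q.1 + q.2 < B)]
  · refine Finset.sum_bij' (fun p _ => p.2) (fun q _ => ⟨q.1 + q.2, q⟩) ?_ ?_ ?_ ?_ ?_
    · rintro ⟨N, p⟩ hp
      simp only [Finset.mem_sigma, Finset.mem_range, mem_antidiagonal] at hp
      simp only [Finset.mem_filter, Finset.mem_product, Finset.mem_range]
      omega
    · intro q hq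
      simp only [Finset.mem_filter, Finset.mem_product, Finset.mem_range] at hq
      simp [hq.2]
    · rintro ⟨N, p⟩ hp
      simp only [Finset.mem_sigma, Finset.mem_range, mem_antidiagonal] at hp
      obtain ⟨-, rfl⟩ := hp
      rfl
    · intro q _
      rfl
    · intro p _
      rfl
  · intro q _ hq
    by_contra hlt
    exact hq (h _ _ (by omega))

theorem sum_range_shift (g : ℕ → E) (a B : ℕ) (h : ∀ N, B ≤ N → g N = 0) :
    ∑ r ∈ Finset.range B, g (r + a) =
      ∑ N ∈ Finset.range B, if a ≤ N then g N else 0 := by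
  rw [← Finset.sum_filter]
  have : ∑ r ∈ Finset.range B, g (r + a) =
      ∑ r ∈ (Finset.range B).filter (fun r => r + a < B), g (r + a) := by
    symm
    apply Finset.sum_filter_of_ne
    intro r _ hr
    by_contra hlt
    exact hr (h _ (by omega))
  rw [this]
  refine Finset.sum_bij' (fun r _ => r + a) (fun N _ => N - a) ?_ ?_ ?_ ?_ ?_
  · intro r hr
    simp only [Finset.mem_filter, Finset.mem_range] at hr ⊢
    omega
  · intro r hr
    simp only [Finset.mem_filter, Finset.mem_range] at hr ⊢
    omega
  · intro r hr
    simp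
  · intro r hr
    simp only [Finset.mem_filter, Finset.mem_range] at hr ⊢
    omega
  · intro r hr
    rfl

/-- The product rule for `d/dx` on coefficients: on the antidiagonal the factor `p + 1` splits as
`x.1 + x.2`. -/
theorem sum_antidiagonal_smul_eq {F : Type*} [AddCommGroup F] [Module ℂ F] (g : ℕ → ℕ → F)
    (p : ℕ) :
    ((p : ℂ) + 1) • ∑ x ∈ antidiagonal (p + 1), g x.1 x.2 =
      (∑ x ∈ antidiagonal p, ((x.1 : ℂ) + 1) • g (x.1 + 1) x.2) +
        ∑ x ∈ antidiagonal p, ((x.2 : ℂ) + 1) • g x.1 (x.2 + 1) := by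
  have h1 : ∑ x ∈ antidiagonal (p + 1), (x.1 : ℂ) • g x.1 x.2 =
      ∑ x ∈ antidiagonal p, ((x.1 : ℂ) + 1) • g (x.1 + 1) x.2 := by
    rw [Finset.Nat.sum_antidiagonal_succ]
    simp
  have h2 : ∑ x ∈ antidiagonal (p + 1), (x.2 : ℂ) • g x.1 x.2 =
      ∑ x ∈ antidiagonal p, ((x.2 : ℂ) + 1) • g x.1 (x.2 + 1) := by
    rw [Finset.Nat.sum_antidiagonal_succ']
    simp
  rw [← h1, ← h2, ← Finset.sum_add_distrib, Finset.smul_sum]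
  refine Finset.sum_congr rfl fun x hx => ?_
  rw [← add_smul]
  congr 1
  rw [mem_antidiagonal] at hx
  exact_mod_cast hx.symm

end Sums

/-! ### Binomial identities -/

section Choose

theorem choose_mul_choose_natCast (k : ℂ) (i a : ℕ) :
    Ring.choose k i * Ring.choose (i : ℂ) a =
      Ring.choose k a * if a ≤ i then Ring.choose (k - a) (i - a) else 0 := by
  rw [Ring.choose_natCast]
  split_ifs with h
  · rw [← Ring.choose_smul_choose k h, nsmul_eq_mul, mul_comm]
  · rw [Nat.choose_eq_zero_of_lt (by omega)]
    simp

theorem choose_mul_choose_sub (k : ℂ) (i a : ℕ) :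
    Ring.choose k i * Ring.choose (k - i) a = Ring.choose k a * Ring.choose (k - a) i := by
  have h1 := Ring.choose_smul_choose k (Nat.le_add_right i a)
  have h2 := Ring.choose_smul_choose k (Nat.le_add_left a i)
  rw [Nat.add_sub_cancel_left] at h1
  rw [Nat.add_sub_cancel] at h2
  rw [← h1, ← h2, Nat.choose_symm_add]

/-- Coefficient of `y^i w^s` in `(1+w)^m (1+y(1+w))^k`, with the last factor expanded either in
`y(1+w)` or as `((1+y) + yw)^k`. -/
theorem choose_mul_choose_add (k m : ℂ) (i s : ℕ) :
    Ring.choose k i * Ring.choose (m + i) s =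
      ∑ p ∈ antidiagonal s, Ring.choose k p.1 * Ring.choose m p.2 *
        if p.1 ≤ i then Ring.choose (k - p.1) (i - p.1) else 0 := by
  rw [add_comm m, Ring.add_choose_eq s (Commute.all _ _), Finset.mul_sum]
  refine Finset.sum_congr rfl fun p _ => ?_
  rw [← mul_assoc, choose_mul_choose_natCast]
  ring

/-- Coefficient of `y^N w^s` in `(1+w)^m (1+y+yw)^k (1+y)^n`, computed in the same two ways. It
serves `delta_commutator`. -/
theorem sum_choose_mul_choose_add (k m n : ℂ) (N s : ℕ) :
    ∑ q ∈ antidiagonal N, Ring.choose k q.1 * Ring.choose n q.2 *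
        Ring.choose (m + q.1) s =
      ∑ p ∈ antidiagonal s, Ring.choose k p.1 * Ring.choose m p.2 *
        if p.1 ≤ N then Ring.choose (k - p.1 + n) (N - p.1) else 0 := by
  have h : ∀ a : ℕ, ∑ q ∈ antidiagonal N,
      (if a ≤ q.1 then Ring.choose (k - a) (q.1 - a) else 0) * Ring.choose n q.2 =
      if a ≤ N then Ring.choose (k - a + n) (N - a) else 0 := by
    intro a
    split_ifs with ha
    · obtain ⟨M, rfl⟩ := Nat.exists_eq_add_of_le ha
      rw [Nat.add_sub_cancel_left, Ring.add_choose_eq M (Commute.all _ _)]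
      symm
      refine Finset.sum_of_injOn (fun q => (q.1 + a, q.2)) ?_ ?_ ?_ ?_
      · intro x _ y _ hxy
        simp only [Prod.mk.injEq, add_left_inj] at hxy
        exact Prod.ext hxy.1 hxy.2
      · intro x hx
        simp only [Finset.mem_coe, mem_antidiagonal] at hx ⊢
        omega
      · rintro ⟨i, j⟩ hx hn
        simp only [mem_antidiagonal] at hx
        split_ifs with hai
        · refine absurd ⟨(i - a, j), ?_, ?_⟩ hn
          · simp only [Finset.mem_coe, mem_antidiagonal]
            omega
          · simp [Nat.sub_add_cancel hai]
        · simp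
      · intro x _
        simp
    · refine Finset.sum_eq_zero fun q hq => ?_
      rw [mem_antidiagonal] at hq
      rw [if_neg (by omega), zero_mul]
  simp_rw [← h, Finset.mul_sum]
  rw [Finset.sum_comm]
  refine Finset.sum_congr rfl fun q _ => ?_
  rw [mul_right_comm, choose_mul_choose_add, Finset.sum_mul]
  refine Finset.sum_congr rfl fun p _ => ?_
  ring

/-- Coefficient of `y^N w^s` in `(1+w)^m (1+w+y)^k (1+y)^n`, with the middle factor expanded in
powers of `y` or of `w`. It serves `oppDelta_commutator`. -/
theorem sum_choose_mul_choose_sub (k m n : ℂ) (N s : ℕ) :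
    ∑ q ∈ antidiagonal N, Ring.choose k q.1 * Ring.choose n q.2 *
        Ring.choose (m + k - q.1) s =
      ∑ p ∈ antidiagonal s, Ring.choose k p.1 * Ring.choose m p.2 *
        Ring.choose (k - p.1 + n) N := by
  simp_rw [Ring.add_choose_eq N (Commute.all _ n), Finset.mul_sum]
  rw [Finset.sum_comm]
  refine Finset.sum_congr rfl fun q _ => ?_
  rw [show m + k - q.1 = (k - q.1) + m by ring, Ring.add_choose_eq s (Commute.all _ _),
    Finset.mul_sum]
  refine Finset.sum_congr rfl fun p _ => ?_
  linear_combination Ring.choose n q.2 * Ring.choose m p.2 * choose_mul_choose_sub k q.1 p.1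

theorem choose_neg_eq (r : ℂ) (n : ℕ) :
    Ring.choose (-r) n = (-1) ^ n * Ring.choose (r + n - 1) n := by
  rw [Ring.choose_neg]
  simp [Int.negOnePow, Units.smul_def]

/-- Coefficient of `w^s` in `(1+w)^M (1 - w/(1+w))^m = (1+w)^(M-m)`. -/
theorem sum_neg_one_pow_choose_mul_choose (m M : ℂ) (s : ℕ) :
    ∑ q ∈ antidiagonal s, (-1) ^ q.1 * Ring.choose m q.1 * Ring.choose (M - q.1) q.2 =
      Ring.choose (M - m) s := by
  have h : ∀ q ∈ antidiagonal s,
      (-1) ^ q.1 * Ring.choose m q.1 * Ring.choose (M - q.1) q.2 =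
        (-1) ^ s * (Ring.choose m q.1 * Ring.choose (s - 1 - M) q.2) := by
    intro q hq
    rw [mem_antidiagonal] at hq
    rw [show M - q.1 = -((q.1 : ℂ) - M) by ring, choose_neg_eq, ← hq, pow_add]
    push_cast
    rw [show (q.1 : ℂ) - M + q.2 - 1 = q.1 + q.2 - 1 - M by ring]
    ring
  rw [Finset.sum_congr rfl h, ← Finset.mul_sum, ← Ring.add_choose_eq s (Commute.all _ _),
    show M - m = -(m - M) by ring, choose_neg_eq]
  congr 2
  ring

theorem succ_mul_choose_succ (K : ℂ) (b : ℕ) :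
    ((b : ℂ) + 1) * Ring.choose K (b + 1) = (K - b) * Ring.choose K b := by
  have := Ring.choose_smul_choose K (Nat.le_succ b)
  rw [Nat.succ_sub (le_refl b), Nat.sub_self, Ring.choose_one_right, nsmul_eq_mul,
    Nat.succ_eq_add_one, Nat.choose_succ_self_right] at this
  push_cast at this
  rw [this, mul_comm]

end Choose

/-! ### Commutators of vertex operator modes -/

section Modes

variable {V W : Type*} [AddCommGroup V] [Module ℂ V] [AddCommGroup W] [Module ℂ W]

theorem vertexMode_add (Y : V →ₗ[ℂ] VertexOperator ℂ W) (u v : V) (n : ℤ) :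
    vertexMode Y (u + v) n = vertexMode Y u n + vertexMode Y v n := by
  simp [vertexMode]

theorem vertexMode_smul (Y : V →ₗ[ℂ] VertexOperator ℂ W) (c : ℂ) (v : V) (n : ℤ) :
    vertexMode Y (c • v) n = c • vertexMode Y v n := by
  simp [vertexMode]

theorem vertexMode_sum {ι : Type*} (s : Finset ι) (f : ι → V) (Y : V →ₗ[ℂ] VertexOperator ℂ W)
    (n : ℤ) : vertexMode Y (∑ i ∈ s, f i) n = ∑ i ∈ s, vertexMode Y (f i) n := by
  simp [vertexMode]

/-- The commutator formula for the modes of vertex operators. -/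
theorem vertexMode_commutator {Y : V →ₗ[ℂ] VertexOperator ℂ V} {YW : V →ₗ[ℂ] VertexOperator ℂ W}
    (hJ : JacobiIdentity Y YW) (u v : V) (m n : ℤ) (S : ℕ)
    (hS : ∀ s : ℕ, S ≤ s → vertexMode Y u s v = 0) :
    vertexMode YW u m * vertexMode YW v n - vertexMode YW v n * vertexMode YW u m =
      ∑ s ∈ Finset.range S, Ring.choose (m : ℂ) s •
        vertexMode YW (vertexMode Y u s v) (m + n - s) := by
  ext w
  have h := hJ u v w 0 m n
  -- For `l = 0` the binomials `choose 0 i` leave only `i = 0` on the left of the Jacobi identity.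
  rw [finsum_eq_single _ 0, finsum_eq_single _ 0,
    finsum_eq_sum_of_support_subset (s := Finset.range S)] at h
  · simpa [LinearMap.sum_apply] using h
  · intro s hs
    by_contra hlt
    apply hs
    simp only [Finset.coe_range, Set.mem_Iio, not_lt] at hlt
    simp [hS s hlt, vertexMode_zero_left]
  · intro i hi
    simp [Ring.choose_zero_ite, hi]
  · intro i hi
    simp [Ring.choose_zero_ite, hi]

theorem vertexMode_commutator_nat {Y : V →ₗ[ℂ] VertexOperator ℂ V}
    {YW : V →ₗ[ℂ] VertexOperator ℂ W} (hJ : JacobiIdentity Y YW) (u v : V) (m : ℕ) (n : ℤ) :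
    vertexMode YW u m * vertexMode YW v n - vertexMode YW v n * vertexMode YW u m =
      ∑ s ∈ Finset.range (m + 1), (m.choose s : ℂ) •
        vertexMode YW (vertexMode Y u s v) (m + n - s) := by
  obtain ⟨N, hN⟩ := vertexMode_truncation Y u v
  rw [vertexMode_commutator hJ u v m n (max N.toNat (m + 1)) fun s hs => hN s (by omega)]
  symm
  have hc : ∀ s : ℕ, Ring.choose ((m : ℤ) : ℂ) s = (m.choose s : ℂ) := fun s => by
    simpa using Ring.choose_natCast (R := ℂ) m s
  simp_rw [hc]
  refine Finset.sum_subset (fun x hx => ?_) fun x _ hx => ?_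
  · simp only [Finset.mem_range] at hx ⊢
    omega
  · rw [Nat.choose_eq_zero_of_lt (by simpa using hx)]
    simp

end Modes

/-! ### Conjugation by `exp(x L(1))` -/

namespace VertexOperatorAlgebra

variable {V : Type*} [AddCommGroup V] [Module ℂ V] (A : VertexOperatorAlgebra V)

theorem L_zero_mode {h : ℤ} {u : V} (hu : u ∈ A.grade h) (i : ℤ) (v : V) :
    vertexMode A.Y A.conformal 1 (vertexMode A.Y u i v) =
      ((h : ℂ) - i - 1) • vertexMode A.Y u i v +
        vertexMode A.Y u i (vertexMode A.Y A.conformal 1 v) := by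
  have h1 := LinearMap.congr_fun (vertexMode_commutator_nat A.jacobi A.conformal u 1 i) v
  simp only [Finset.sum_range_succ, Finset.range_zero, Finset.sum_empty, LinearMap.sub_apply,
    Module.End.mul_apply, LinearMap.add_apply, LinearMap.smul_apply, Nat.cast_zero, Nat.cast_one,
    A.L_neg_one_derivative, A.L_zero h u hu, vertexMode_smul, Nat.choose_self,
    Nat.choose_zero_right, one_smul, zero_add] at h1
  rw [sub_eq_iff_eq_add] at h1
  rw [h1, show (1 : ℤ) + i - 0 - 1 = i by ring, show (1 : ℤ) + i - 1 = i by ring]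
  push_cast
  module

theorem mode_mem_grade {h h' : ℤ} {u v : V} (hu : u ∈ A.grade h) (hv : v ∈ A.grade h') (i : ℤ) :
    vertexMode A.Y u i v ∈ A.grade (h + h' - i - 1) := by
  apply A.mem_grade_of_L_zero
  rw [A.L_zero_mode hu, A.L_zero h' v hv, map_smul]
  push_cast
  module

theorem L_neg_one_mem {h : ℤ} {v : V} (hv : v ∈ A.grade h) :
    vertexMode A.Y A.conformal 0 v ∈ A.grade (h + 1) := by
  convert A.mode_mem_grade A.conformal_mem hv 0 using 2
  ring

/-- The commutator with `ω₂` has three terms, from `L(-1)u`, `L(0)u` and `L(1)u`; the first two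
combine by the derivative property. -/
theorem LOne_mode {h : ℤ} {u : V} (hu : u ∈ A.grade h) (i : ℤ) (v : V) :
    A.LOne (vertexMode A.Y u i v) =
      (2 * (h : ℂ) - i - 2) • vertexMode A.Y u (i + 1) v +
        vertexMode A.Y (A.LOne u) i v + vertexMode A.Y u i (A.LOne v) := by
  have h1 := LinearMap.congr_fun (vertexMode_commutator_nat A.jacobi A.conformal u 2 i) v
  simp only [Finset.sum_range_succ, Finset.range_zero, Finset.sum_empty, LinearMap.sub_apply,
    Module.End.mul_apply, LinearMap.add_apply, LinearMap.smul_apply, Nat.cast_zero, Nat.cast_one,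
    Nat.cast_ofNat, A.L_neg_one_derivative, A.L_zero h u hu, vertexMode_smul, Nat.choose_self,
    Nat.choose_zero_right, Nat.choose_one_right, one_smul, zero_add] at h1
  rw [sub_eq_iff_eq_add] at h1
  unfold LOne
  rw [h1, show (2 : ℤ) + i - 0 - 1 = i + 1 by ring, show (2 : ℤ) + i - 1 = i + 1 by ring,
    show (2 : ℤ) + i - 2 = i by ring]
  push_cast
  module

/-- The divided power `L(1)^j / j!`. -/
noncomputable def LOneDiv (j : ℕ) : Module.End ℂ V := (j.factorial : ℂ)⁻¹ • A.LOne ^ j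

theorem LOneDiv_zero : A.LOneDiv 0 = 1 := by
  simp [LOneDiv]

theorem LOne_LOneDiv (j : ℕ) (v : V) :
    A.LOne (A.LOneDiv j v) = ((j : ℂ) + 1) • A.LOneDiv (j + 1) v := by
  simp only [LOneDiv, LinearMap.smul_apply, map_smul, pow_succ', Module.End.mul_apply, smul_smul]
  congr 1
  rw [Nat.factorial_succ]
  push_cast
  rw [mul_inv, mul_inv_cancel_left₀]
  exact_mod_cast Nat.succ_ne_zero j

theorem LOneDiv_mem {h : ℤ} {v : V} (hv : v ∈ A.grade h) (j : ℕ) :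
    A.LOneDiv j v ∈ A.grade (h - j) := by
  rw [LOneDiv, LinearMap.smul_apply]
  apply Submodule.smul_mem
  induction j with
  | zero => simpa using hv
  | succ j ih =>
    rw [pow_succ', Module.End.mul_apply]
    convert A.LOne_mem _ _ ih using 2
    push_cast
    ring

theorem eventually_LOneDiv_eq_zero {h : ℤ} {v : V} (hv : v ∈ A.grade h) :
    ∃ J : ℕ, ∀ j : ℕ, J ≤ j → A.LOneDiv j v = 0 := by
  obtain ⟨J, hJ⟩ := A.LOne_pow_eq_zero h v hv
  exact ⟨J, fun j hj => by simp [LOneDiv, hJ j hj]⟩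

/-- The coefficients of `e^{x L(1)} Y(u, x₀) e^{-x L(1)}` for `u` of weight `h`. -/
noncomputable def expLOneMode (h : ℤ) (u : V) (i : ℤ) (q : ℕ) : Module.End ℂ V :=
  ∑ x ∈ antidiagonal q, Ring.choose (2 * (h : ℂ) - 2 - i - x.1) x.2 •
    vertexMode A.Y (A.LOneDiv x.1 u) (i + x.2)

/-- The coefficient form of the differential equation `dE/dx = [L(1), E]` satisfied by `E =
e^{xL(1)} Y(u, x₀) e^{-xL(1)}`. -/
theorem LOne_expLOneMode {h : ℤ} {u : V} (hu : u ∈ A.grade h) (i : ℤ) (q : ℕ) (v : V) :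
    A.LOne (A.expLOneMode h u i q v) =
      ((q : ℂ) + 1) • A.expLOneMode h u i (q + 1) v + A.expLOneMode h u i q (A.LOne v) := by
  have key : ((q : ℂ) + 1) • A.expLOneMode h u i (q + 1) v =
      ∑ x ∈ antidiagonal q, Ring.choose (2 * (h : ℂ) - 2 - i - x.1) x.2 •
        ((2 * ((h - x.1 : ℤ) : ℂ) - (i + x.2 : ℤ) - 2) •
          vertexMode A.Y (A.LOneDiv x.1 u) (i + x.2 + 1) v +
        ((x.1 : ℂ) + 1) • vertexMode A.Y (A.LOneDiv (x.1 + 1) u) (i + x.2) v) := by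
    have h1 := sum_antidiagonal_smul_eq (fun a b =>
      Ring.choose (2 * (h : ℂ) - 2 - i - a) b •
        vertexMode A.Y (A.LOneDiv a u) (i + b) v) q
    simp only [expLOneMode, LinearMap.sum_apply, LinearMap.smul_apply]
    rw [h1]
    -- After `succ_mul_choose_succ` the two sides of `key` differ by these two sums. Shifting the
    -- index pair by one identifies them through Pascal's rule.
    have h2 : ∑ x ∈ antidiagonal q, (x.1 : ℂ) • Ring.choose (2 * (h : ℂ) - 2 - i - x.1) x.2 •
        vertexMode A.Y (A.LOneDiv x.1 u) (i + x.2 + 1) v =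
        ∑ x ∈ antidiagonal q, ((x.1 : ℂ) + 1) •
          (Ring.choose (2 * (h : ℂ) - 2 - i - x.1) x.2 -
            Ring.choose (2 * (h : ℂ) - 2 - i - (x.1 + 1)) x.2) •
          vertexMode A.Y (A.LOneDiv (x.1 + 1) u) (i + x.2) v := by
      rcases q with _ | q
      · simp
      · rw [Finset.Nat.sum_antidiagonal_succ, Finset.Nat.sum_antidiagonal_succ']
        simp only [Nat.cast_zero, zero_smul, zero_add, Ring.choose_zero_right, sub_self, smul_zero]
        refine Finset.sum_congr rfl fun x _ => ?_
        have := Ring.choose_succ_succ (2 * (h : ℂ) - 2 - i - (x.1 + 1)) x.2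
        rw [show 2 * (h : ℂ) - 2 - i - (x.1 + 1) + 1 = 2 * (h : ℂ) - 2 - i - x.1 by ring] at this
        rw [this]
        push_cast
        rw [add_sub_cancel_right, add_assoc i]
    rw [← sub_eq_zero]
    rw [← sub_eq_zero] at h2
    rw [← Finset.sum_sub_distrib] at h2
    rw [← Finset.sum_add_distrib, ← Finset.sum_sub_distrib, ← h2]
    refine Finset.sum_congr rfl fun x _ => ?_
    have h3 := succ_mul_choose_succ (2 * (h : ℂ) - 2 - i - x.1) x.2
    rw [smul_smul ((x.2 : ℂ) + 1), h3]
    push_cast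
    rw [add_assoc i]
    module
  rw [key]
  simp only [expLOneMode, LinearMap.sum_apply, LinearMap.smul_apply, map_sum, map_smul]
  rw [← Finset.sum_add_distrib]
  refine Finset.sum_congr rfl fun x _ => ?_
  rw [A.LOne_mode (A.LOneDiv_mem hu x.1), LOne_LOneDiv, vertexMode_smul, ← smul_add]
  rfl

/-- The conjugation formula for `L(1)`, in terms of divided powers. -/
theorem LOneDiv_mode {h : ℤ} {u : V} (hu : u ∈ A.grade h) (i : ℤ) (v : V) (p : ℕ) :
    A.LOneDiv p (vertexMode A.Y u i v) =
      ∑ x ∈ antidiagonal p, A.expLOneMode h u i x.1 (A.LOneDiv x.2 v) := by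
  induction p with
  | zero => simp [LOneDiv_zero, expLOneMode]
  | succ p ih =>
    have hp : (p : ℂ) + 1 ≠ 0 := by exact_mod_cast Nat.succ_ne_zero p
    -- Multiplied by `p + 1`, degree `p + 1` becomes `L(1)` applied to degree `p`, so the
    -- differential equation drives the induction.
    apply smul_right_injective V hp
    beta_reduce
    rw [← LOne_LOneDiv, ih, sum_antidiagonal_smul_eq
      (fun a b => A.expLOneMode h u i a (A.LOneDiv b v)), ← Finset.sum_add_distrib, map_sum]
    refine Finset.sum_congr rfl fun x _ => ?_
    rw [A.LOne_expLOneMode hu, LOne_LOneDiv, map_smul]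

/-- Moving `L(-1)` to the left costs `[L(1), L(-1)] = 2L(0)` at weights `h, h-1, …, h-j`, in total
`(j+1)(2h-j)`. -/
theorem LOneDiv_L_neg_one {h : ℤ} {v : V} (hv : v ∈ A.grade h) (j : ℕ) :
    A.LOneDiv (j + 1) (vertexMode A.Y A.conformal 0 v) =
      vertexMode A.Y A.conformal 0 (A.LOneDiv (j + 1) v) +
        (2 * (h : ℂ) - j) • A.LOneDiv j v := by
  have hL : ∀ x : V, A.LOne (vertexMode A.Y A.conformal 0 x) =
      vertexMode A.Y A.conformal 0 (A.LOne x) + (2 : ℂ) • vertexMode A.Y A.conformal 1 x := by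
    intro x
    have h1 := LinearMap.congr_fun (A.virasoro 1 (-1)) x
    norm_num at h1
    rw [sub_eq_iff_eq_add] at h1
    rw [add_comm]
    exact h1
  induction j with
  | zero =>
    have := LOne_LOneDiv A 0
    simp only [LOneDiv_zero, Module.End.one_apply, Nat.cast_zero, zero_add, one_smul] at this ⊢
    rw [← this, ← this, hL, A.L_zero h v hv, smul_smul]
    simp
  | succ j ih =>
    have hp : ((j + 1 : ℕ) : ℂ) + 1 ≠ 0 := by exact_mod_cast Nat.succ_ne_zero (j + 1)
    apply smul_right_injective V hp
    beta_reduce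
    rw [← LOne_LOneDiv, ih, map_add, hL, smul_add, LOne_LOneDiv, map_smul, map_smul, LOne_LOneDiv,
      A.L_zero _ _ (A.LOneDiv_mem hv (j + 1))]
    push_cast
    module

end VertexOperatorAlgebra

/-! ### Homogeneous components -/

namespace VertexOperatorAlgebra

variable {V : Type*} [AddCommGroup V] [Module ℂ V] (A : VertexOperatorAlgebra V)

theorem component_add (h : ℤ) (u v : V) :
    A.component h (u + v) = A.component h u + A.component h v := by
  simp [component]

theorem component_smul (h : ℤ) (c : ℂ) (v : V) :
    A.component h (c • v) = c • A.component h v := by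
  let _ := A.isInternal.chooseDecomposition
  simp [component, DirectSum.smul_apply]

theorem component_of_mem {h : ℤ} {v : V} (hv : v ∈ A.grade h) : A.component h v = v := by
  let _ := A.isInternal.chooseDecomposition
  simp [component, DirectSum.decompose_of_mem_same _ hv]

theorem component_of_mem_ne {h k : ℤ} {v : V} (hv : v ∈ A.grade h) (hk : k ≠ h) :
    A.component k v = 0 := by
  let _ := A.isInternal.chooseDecomposition
  simp [component, DirectSum.decompose_of_mem_ne _ hv hk.symm]

theorem homogeneous_induction {P : V → Prop} (hom : ∀ h : ℤ, ∀ v ∈ A.grade h, P v) (zero : P 0)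
    (add : ∀ u v, P u → P v → P (u + v)) (v : V) : P v :=
  Submodule.iSup_induction (p := A.grade) (motive := P)
    (by rw [A.isInternal.submodule_iSup_eq_top]; trivial) hom zero add

end VertexOperatorAlgebra

/-! ### Opposite vertex operators -/

namespace VertexOperatorModule

variable {V : Type*} [AddCommGroup V] [Module ℂ V] {A : VertexOperatorAlgebra V}
variable {W : Type*} [AddCommGroup W] [Module ℂ W] (M : VertexOperatorModule A W)

theorem finite_support_oppMode_aux (v : V) (n h : ℤ) :
    (Function.support fun j : ℕ => ((-1 : ℂ) ^ h / (j.factorial : ℂ)) •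
      vertexMode M.Y ((A.LOne ^ j) (A.component h v)) (2 * h - j - n - 2)).Finite := by
  obtain ⟨J, hJ⟩ := A.LOne_pow_eq_zero h _ (A.component_mem h v)
  refine (Set.finite_Iio J).subset fun j hj => ?_
  by_contra hlt
  exact hj (by simp [hJ j (by simpa using hlt), vertexMode_zero_left])

theorem finite_support_oppMode (v : V) (n : ℤ) :
    (Function.support fun h : ℤ => ∑ᶠ j : ℕ, ((-1 : ℂ) ^ h / (j.factorial : ℂ)) •
      vertexMode M.Y ((A.LOne ^ j) (A.component h v)) (2 * h - j - n - 2)).Finite := by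
  refine (A.finite_component v).subset fun h hh hz => hh ?_
  simp [hz, vertexMode_zero_left]

theorem oppMode_add (u v : V) (n : ℤ) :
    M.oppMode (u + v) n = M.oppMode u n + M.oppMode v n := by
  unfold oppMode
  rw [← finsum_add_distrib (M.finite_support_oppMode u n) (M.finite_support_oppMode v n)]
  refine finsum_congr fun h => ?_
  rw [← finsum_add_distrib (M.finite_support_oppMode_aux u n h)
    (M.finite_support_oppMode_aux v n h)]
  refine finsum_congr fun j => ?_
  rw [A.component_add, map_add, vertexMode_add, smul_add]

theorem oppMode_smul (c : ℂ) (v : V) (n : ℤ) : M.oppMode (c • v) n = c • M.oppMode v n := by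
  unfold oppMode
  rw [smul_finsum' c (M.finite_support_oppMode v n)]
  refine finsum_congr fun h => ?_
  rw [smul_finsum' c (M.finite_support_oppMode_aux v n h)]
  refine finsum_congr fun j => ?_
  rw [A.component_smul, map_smul, vertexMode_smul, smul_comm]

theorem oppMode_zero_left (n : ℤ) : M.oppMode 0 n = 0 := by
  simpa using M.oppMode_smul 0 0 n

theorem oppMode_of_mem {h : ℤ} {v : V} (hv : v ∈ A.grade h) (n : ℤ) (B : ℕ)
    (hB : ∀ j, B ≤ j → A.LOneDiv j v = 0) :
    M.oppMode v n = (-1 : ℂ) ^ h • ∑ j ∈ Finset.range B,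
      vertexMode M.Y (A.LOneDiv j v) (2 * h - j - n - 2) := by
  have hterm : ∀ j : ℕ, ((-1 : ℂ) ^ h / (j.factorial : ℂ)) •
      vertexMode M.Y ((A.LOne ^ j) v) (2 * h - j - n - 2) =
      (-1 : ℂ) ^ h • vertexMode M.Y (A.LOneDiv j v) (2 * h - j - n - 2) := by
    intro j
    rw [VertexOperatorAlgebra.LOneDiv, LinearMap.smul_apply, vertexMode_smul, smul_smul,
      div_eq_mul_inv]
  unfold oppMode
  rw [finsum_eq_single _ h, A.component_of_mem hv, finsum_congr hterm,
    finsum_eq_sum_of_support_subset (s := Finset.range B), Finset.smul_sum]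
  · intro j hj
    by_contra hlt
    exact hj (by simp [hB j (by simpa using hlt), vertexMode_zero_left])
  · intro k hk
    simp [A.component_of_mem_ne hv hk, vertexMode_zero_left]

/-- The `L(-1)`-derivative property of the opposite vertex operators. -/
theorem oppMode_L_neg_one (v : V) (n : ℤ) :
    M.oppMode (vertexMode A.Y A.conformal 0 v) n = (-(n : ℂ)) • M.oppMode v (n - 1) := by
  induction v using A.homogeneous_induction with
  | zero => simp [oppMode_zero_left]
  | add u v hu hv => rw [map_add, oppMode_add, oppMode_add, hu, hv, smul_add]
  | hom h v hv =>
    obtain ⟨B₁, hB₁⟩ := A.eventually_LOneDiv_eq_zero hv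
    obtain ⟨B₂, hB₂⟩ := A.eventually_LOneDiv_eq_zero (A.L_neg_one_mem hv)
    set B := max B₁ B₂
    have h1 : ∀ j, B ≤ j → A.LOneDiv j v = 0 := fun j hj =>
      hB₁ j ((le_max_left _ _).trans hj)
    have h2 : ∀ j, B ≤ j → A.LOneDiv j (vertexMode A.Y A.conformal 0 v) = 0 := fun j hj =>
      hB₂ j ((le_max_right _ _).trans hj)
    rw [M.oppMode_of_mem hv _ (B + 1) fun j hj => h1 j (by omega),
      M.oppMode_of_mem (A.L_neg_one_mem hv) _ (B + 1) fun j hj => h2 j (by omega)]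
    -- The term `j = 0` has no `L(0)` correction; the others are shifted down by one, hence the
    -- range `B + 1` above.
    have h3 : ∑ j ∈ Finset.range (B + 1), vertexMode M.Y
        (A.LOneDiv j (vertexMode A.Y A.conformal 0 v)) (2 * (h + 1) - j - n - 2) =
        ∑ j ∈ Finset.range (B + 1), vertexMode M.Y (vertexMode A.Y A.conformal 0 (A.LOneDiv j v))
          (2 * (h + 1) - j - n - 2) +
        ∑ j ∈ Finset.range B, (2 * (h : ℂ) - j) • vertexMode M.Y (A.LOneDiv j v)
          (2 * (h + 1) - (j + 1 : ℕ) - n - 2) := by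
      rw [Finset.sum_range_succ', Finset.sum_range_succ' (fun j =>
        vertexMode M.Y (vertexMode A.Y A.conformal 0 (A.LOneDiv j v)) (2 * (h + 1) - j - n - 2))]
      simp only [A.LOneDiv_L_neg_one hv, vertexMode_add, vertexMode_smul,
        Finset.sum_add_distrib, A.LOneDiv_zero, Module.End.one_apply]
      abel
    rw [h3, Finset.sum_range_succ, h1 B le_rfl, map_zero, vertexMode_zero_left, add_zero,
      ← Finset.sum_add_distrib, Finset.sum_range_succ, h1 B le_rfl, vertexMode_zero_left, add_zero,
      smul_comm, zpow_add_one₀ (by norm_num), mul_neg_one, neg_smul, ← smul_neg,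
      Finset.smul_sum, ← Finset.sum_neg_distrib]
    congr 1
    refine Finset.sum_congr rfl fun j _ => ?_
    rw [M.L_neg_one_derivative,
      show 2 * (h + 1) - (j : ℤ) - n - 2 - 1 = 2 * h - j - (n - 1) - 2 by ring,
      show 2 * (h + 1) - ((j + 1 : ℕ) : ℤ) - n - 2 = 2 * h - j - (n - 1) - 2 by push_cast; ring]
    push_cast
    module

/-- Both sides expand in modes of `(L(1)^a u/a!)_s (L(1)^c v/c!)`: the left by the commutator
formula on `W`, the right by the conjugation formula. The coefficients then agree by an alternating
Vandermonde sum. Allowing every `S ≥ S₀` lets sums of vectors share a truncation. -/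
theorem oppMode_commutator_of_mem {h h' : ℤ} {u v : V} (hu : u ∈ A.grade h)
    (hv : v ∈ A.grade h') :
    ∃ S₀ : ℕ, ∀ S, S₀ ≤ S → ∀ m n : ℤ,
      M.oppMode u m * M.oppMode v n - M.oppMode v n * M.oppMode u m =
        -∑ s ∈ Finset.range S, Ring.choose (m : ℂ) s •
          M.oppMode (vertexMode A.Y u s v) (m + n - s) := by
  obtain ⟨J₁, hJ₁⟩ := A.eventually_LOneDiv_eq_zero hu
  obtain ⟨J₂, hJ₂⟩ := A.eventually_LOneDiv_eq_zero hv
  choose T hT using fun a c : ℕ => vertexMode_truncation A.Y (A.LOneDiv a u) (A.LOneDiv c v)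
  obtain ⟨T₀, hT₀⟩ : ∃ T₀ : ℕ, ∀ a < J₁, ∀ c < J₂, T a c ≤ T₀ := by
    obtain ⟨b, hb⟩ := ((Finset.range J₁ ×ˢ Finset.range J₂).image
      fun p => (T p.1 p.2).toNat).bddAbove
    refine ⟨b, fun a ha c hc => ?_⟩
    have : (T a c).toNat ≤ b := hb (by
      simp only [Finset.coe_image, Set.mem_image]
      exact ⟨(a, c), by simp [ha, hc], rfl⟩)
    omega
  set B := max (max J₁ J₂) T₀ with hBdef
  have hBu : ∀ a, B ≤ a → A.LOneDiv a u = 0 := fun a ha => hJ₁ a (by omega)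
  have hBv : ∀ c, B ≤ c → A.LOneDiv c v = 0 := fun c hc => hJ₂ c (by omega)
  have hB : ∀ (a c s : ℕ), B ≤ a ∨ B ≤ c ∨ B ≤ s →
      vertexMode A.Y (A.LOneDiv a u) s (A.LOneDiv c v) = 0 := by
    intro a c s hs
    by_cases ha : a < J₁
    · by_cases hc : c < J₂
      · exact hT a c s (by have := hT₀ a ha c hc; omega)
      · simp [hJ₂ c (by omega)]
    · simp [hJ₁ a (by omega), vertexMode_zero_left]
  have hdiv : ∀ i p : ℕ, A.LOneDiv p (vertexMode A.Y u i v) =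
      ∑ x ∈ antidiagonal p, ∑ y ∈ antidiagonal x.1,
        Ring.choose (2 * (h : ℂ) - 2 - i - y.1) y.2 •
          vertexMode A.Y (A.LOneDiv y.1 u) ((i + y.2 : ℕ) : ℤ) (A.LOneDiv x.2 v) := by
    intro i p
    rw [A.LOneDiv_mode hu]
    refine Finset.sum_congr rfl fun x _ => ?_
    simp only [VertexOperatorAlgebra.expLOneMode, LinearMap.sum_apply, LinearMap.smul_apply]
    push_cast
    rfl
  -- A term of degree `p = a + b + c ≥ 3B` has one of `a`, `b`, `c` at least `B`, and then it
  -- vanishes by `hB`.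
  refine ⟨3 * B, fun S hS m n => ?_⟩
  set Z : ℕ → ℕ → ℕ → Module.End ℂ W := fun a s c =>
    vertexMode M.Y (vertexMode A.Y (A.LOneDiv a u) s (A.LOneDiv c v))
      (2 * h + 2 * h' - 4 - m - n - a - c - s) with hZ
  have hZ0 : ∀ a s c : ℕ, B ≤ a ∨ B ≤ c ∨ B ≤ s → Z a s c = 0 := fun a s c hs => by
    simp only [hZ, hB a c s hs, vertexMode_zero_left]
  have hleft : M.oppMode u m * M.oppMode v n - M.oppMode v n * M.oppMode u m =
      ((-1 : ℂ) ^ h * (-1) ^ h') • ∑ a ∈ Finset.range S, ∑ c ∈ Finset.range S,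
        ∑ s ∈ Finset.range S, Ring.choose (2 * (h : ℂ) - 2 - a - m) s • Z a s c := by
    rw [M.oppMode_of_mem hu _ S fun j hj => hBu j (by omega),
      M.oppMode_of_mem hv _ S fun j hj => hBv j (by omega), smul_mul_smul_comm,
      smul_mul_smul_comm, mul_comm ((-1 : ℂ) ^ h'), ← smul_sub, Finset.sum_mul_sum,
      Finset.sum_mul_sum, Finset.sum_comm (s := Finset.range S) (t := Finset.range S)
        (f := fun c a => vertexMode M.Y (A.LOneDiv c v) _ * _), ← Finset.sum_sub_distrib]
    congr 1
    refine Finset.sum_congr rfl fun a _ => ?_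
    rw [← Finset.sum_sub_distrib]
    refine Finset.sum_congr rfl fun c _ => ?_
    rw [vertexMode_commutator M.jacobi _ _ _ _ S fun s hs => hB a c s (by omega)]
    refine Finset.sum_congr rfl fun s _ => ?_
    simp only [hZ]
    congr 2
    · push_cast
      ring
    · ring
  have hright : ∀ i : ℕ, -M.oppMode (vertexMode A.Y u i v) (m + n - i) =
      ((-1 : ℂ) ^ h * (-1) ^ h') • ∑ c ∈ Finset.range S, ∑ a ∈ Finset.range S,
        ∑ b ∈ Finset.range S, ((-1 : ℂ) ^ i * Ring.choose (2 * (h : ℂ) - 2 - a - i) b) •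
          Z a (i + b) c := by
    intro i
    have hF : ∀ (q c : ℕ), 3 * B ≤ q + c → ∑ y ∈ antidiagonal q,
        Ring.choose (2 * (h : ℂ) - 2 - i - y.1) y.2 •
          vertexMode A.Y (A.LOneDiv y.1 u) ((i + y.2 : ℕ) : ℤ) (A.LOneDiv c v) = 0 := by
      intro q c hqc
      refine Finset.sum_eq_zero fun y hy => ?_
      rw [mem_antidiagonal] at hy
      rw [hB _ _ _ (by omega), smul_zero]
    rw [M.oppMode_of_mem (A.mode_mem_grade hu hv i) _ S fun p hp => ?_]
    -- The weight of `u_i v` is `h + h' - i - 1`; the `-1` reverses the sign of the commutator and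
    -- `(-1)^i` makes the Vandermonde sum alternate.
    · have hsign : (-1 : ℂ) ^ (h + h' - i - 1) = -((-1 : ℂ) ^ h * (-1) ^ h' * (-1) ^ i) := by
        rw [zpow_sub₀ (by norm_num), zpow_sub₀ (by norm_num), zpow_add₀ (by norm_num), zpow_one,
          zpow_natCast, div_eq_mul_inv _ ((-1 : ℂ) ^ i), ← inv_pow, inv_neg_one, div_neg, div_one]
      rw [hsign, neg_smul, neg_neg, mul_smul]
      congr 1
      have hmode : ∀ p ∈ Finset.range S, vertexMode M.Y (A.LOneDiv p (vertexMode A.Y u i v))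
          (2 * (h + h' - i - 1) - p - (m + n - i) - 2) =
          ∑ x ∈ antidiagonal p, ∑ y ∈ antidiagonal x.1,
            Ring.choose (2 * (h : ℂ) - 2 - y.1 - i) y.2 • Z y.1 (i + y.2) x.2 := by
        intro p _
        rw [hdiv, vertexMode_sum]
        refine Finset.sum_congr rfl fun x hx => ?_
        rw [vertexMode_sum]
        refine Finset.sum_congr rfl fun y hy => ?_
        rw [mem_antidiagonal] at hx hy
        rw [vertexMode_smul, sub_right_comm (2 * (h : ℂ) - 2)]
        simp only [hZ]
        congr 2
        rw [← hx, ← hy]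
        push_cast
        ring
      rw [Finset.sum_congr rfl hmode, sum_range_sum_antidiagonal_eq
        (fun q c => ∑ y ∈ antidiagonal q,
          Ring.choose (2 * (h : ℂ) - 2 - y.1 - i) y.2 • Z y.1 (i + y.2) c), Finset.sum_comm,
        Finset.smul_sum]
      · refine Finset.sum_congr rfl fun c _ => ?_
        rw [sum_range_sum_antidiagonal_eq (fun a b =>
          Ring.choose (2 * (h : ℂ) - 2 - a - i) b • Z a (i + b) c)]
        · simp_rw [Finset.smul_sum, smul_smul]
        · intro a b hab
          rw [hZ0 _ _ _ (by omega), smul_zero]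
      · intro q c hqc
        refine Finset.sum_eq_zero fun y hy => ?_
        rw [mem_antidiagonal] at hy
        rw [hZ0 _ _ _ (by omega), smul_zero]
    · rw [hdiv]
      refine Finset.sum_eq_zero fun x hx => hF _ _ ?_
      rw [mem_antidiagonal] at hx
      omega
  rw [hleft, ← Finset.sum_neg_distrib]
  simp_rw [← smul_neg, hright, smul_comm (Ring.choose (m : ℂ) _), ← Finset.smul_sum]
  congr 1
  simp_rw [Finset.smul_sum, smul_smul]
  have hswap : ∀ g : ℕ → ℕ → ℕ → ℕ → Module.End ℂ W,
      ∑ i ∈ Finset.range S, ∑ c ∈ Finset.range S, ∑ a ∈ Finset.range S, ∑ b ∈ Finset.range S,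
        g i c a b = ∑ a ∈ Finset.range S, ∑ c ∈ Finset.range S, ∑ i ∈ Finset.range S,
          ∑ b ∈ Finset.range S, g i c a b := by
    intro g
    rw [Finset.sum_comm, Finset.sum_comm (s := Finset.range S) (t := Finset.range S)
      (f := fun a c => ∑ i ∈ Finset.range S, ∑ b ∈ Finset.range S, g i c a b)]
    exact Finset.sum_congr rfl fun c _ => Finset.sum_comm
  refine Eq.trans ?_ (hswap _).symm
  refine Finset.sum_congr rfl fun a _ => Finset.sum_congr rfl fun c _ => ?_
  rw [← sum_range_sum_antidiagonal_eq (fun i b =>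
    (Ring.choose (m : ℂ) i * ((-1 : ℂ) ^ i * Ring.choose (2 * (h : ℂ) - 2 - a - i) b)) •
      Z a (i + b) c)]
  · refine Finset.sum_congr rfl fun s _ => ?_
    -- Used with top entry `2h - 2 - a`, summing over `i + b = s`.
    rw [← sum_neg_one_pow_choose_mul_choose, Finset.sum_smul]
    refine Finset.sum_congr rfl fun x hx => ?_
    rw [mem_antidiagonal] at hx
    rw [hx]
    congr 1
    ring
  · intro i b hib
    rw [hZ0 _ _ _ (by omega), smul_zero]

/-- The commutator formula for the modes of the opposite vertex operators. -/
theorem oppMode_commutator (u v : V) :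
    ∃ S₀ : ℕ, ∀ S, S₀ ≤ S → ∀ m n : ℤ,
      M.oppMode u m * M.oppMode v n - M.oppMode v n * M.oppMode u m =
        -∑ s ∈ Finset.range S, Ring.choose (m : ℂ) s •
          M.oppMode (vertexMode A.Y u s v) (m + n - s) := by
  induction u using A.homogeneous_induction with
  | zero => exact ⟨0, fun S _ m n => by simp [oppMode_zero_left, vertexMode_zero_left]⟩
  | add u u' hu hu' =>
    obtain ⟨S₁, h₁⟩ := hu
    obtain ⟨S₂, h₂⟩ := hu'
    refine ⟨max S₁ S₂, fun S hS m n => ?_⟩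
    simp only [oppMode_add, vertexMode_add, LinearMap.add_apply, smul_add,
      Finset.sum_add_distrib, neg_add, ← h₁ S (by omega), ← h₂ S (by omega)]
    noncomm_ring
  | hom h u hu =>
    induction v using A.homogeneous_induction with
    | zero => exact ⟨0, fun S _ m n => by simp [oppMode_zero_left]⟩
    | add v v' hv hv' =>
      obtain ⟨S₁, h₁⟩ := hv
      obtain ⟨S₂, h₂⟩ := hv'
      refine ⟨max S₁ S₂, fun S hS m n => ?_⟩
      simp only [oppMode_add, map_add, smul_add,
        Finset.sum_add_distrib, neg_add, ← h₁ S (by omega), ← h₂ S (by omega)]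
      noncomm_ring
    | hom h' v hv => exact M.oppMode_commutator_of_mem hu hv

end VertexOperatorModule

/-! ### Pointwise finite sums of operators -/

section PointwiseSum

variable {W : Type*} [AddCommGroup W] [Module ℂ W]

theorem pointwiseSum_apply_eq_sum (f : ℕ → Module.End ℂ W)
    (hf : ∀ w, (Function.support fun i => f i w).Finite) (w : W) (B : ℕ)
    (hB : ∀ i, B ≤ i → f i w = 0) :
    pointwiseSum f hf w = ∑ i ∈ Finset.range B, f i w := by
  refine finsum_eq_sum_of_support_subset _ fun i hi => ?_
  by_contra hlt
  exact hi (hB i (by simpa using hlt))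

theorem exists_bound_of_finite_support (f : ℕ → Module.End ℂ W)
    (hf : ∀ w, (Function.support fun i => f i w).Finite) (w : W) :
    ∃ B : ℕ, ∀ i, B ≤ i → f i w = 0 := by
  obtain ⟨b, hb⟩ := (hf w).bddAbove
  refine ⟨b + 1, fun i hi => ?_⟩
  by_contra hne
  have : i ≤ b := hb hne
  omega

theorem exists_uniform_bound (p : ℕ → ℕ → Prop) (S : ℕ)
    (h : ∀ s < S, ∃ B : ℕ, ∀ i, B ≤ i → p s i) :
    ∃ B : ℕ, ∀ s < S, ∀ i, B ≤ i → p s i := by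
  induction S with
  | zero => exact ⟨0, fun s hs => absurd hs (Nat.not_lt_zero s)⟩
  | succ S ih =>
    obtain ⟨B₁, h₁⟩ := ih fun s hs => h s (by omega)
    obtain ⟨B₂, h₂⟩ := h S (by omega)
    refine ⟨max B₁ B₂, fun s hs i hi => ?_⟩
    rcases Nat.lt_succ_iff_lt_or_eq.1 hs with hs | rfl
    · exact h₁ s hs i (by omega)
    · exact h₂ i (by omega)

/-- The truncation of `P` depends on the vector `Q j w`, but only finitely many of these are
nonzero, so one bound serves all. -/
theorem exists_pointwiseSum_mul_bound (P Q : ℕ → Module.End ℂ W)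
    (hP : ∀ w, (Function.support fun i => P i w).Finite)
    (hQ : ∀ w, (Function.support fun i => Q i w).Finite) (w : W) :
    ∃ B₀ : ℕ, ∀ B, B₀ ≤ B → pointwiseSum P hP (pointwiseSum Q hQ w) =
      ∑ i ∈ Finset.range B, ∑ j ∈ Finset.range B, P i (Q j w) := by
  obtain ⟨B₁, h₁⟩ := exists_bound_of_finite_support Q hQ w
  obtain ⟨B₂, h₂⟩ := exists_uniform_bound (fun j i => P i (Q j w) = 0) B₁ fun j _ =>
    exists_bound_of_finite_support P hP (Q j w)
  refine ⟨max B₁ B₂, fun B hB => ?_⟩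
  rw [pointwiseSum_apply_eq_sum Q hQ w B fun i hi => h₁ i (by omega), map_sum, Finset.sum_comm]
  refine Finset.sum_congr rfl fun j _ => pointwiseSum_apply_eq_sum P hP _ B fun i hi => ?_
  by_cases hj : j < B₁
  · exact h₂ j hj i (by omega)
  · rw [h₁ j (by omega), map_zero]

/-- The commutator of two pointwise finite sums, arranged by total degree. -/
theorem exists_pointwiseSum_commutator (P Q : ℕ → Module.End ℂ W)
    (hP : ∀ w, (Function.support fun i => P i w).Finite)
    (hQ : ∀ w, (Function.support fun i => Q i w).Finite)
    (R : ℕ → ℕ → Module.End ℂ W) (hR : ∀ s w, ∃ B : ℕ, ∀ N, B ≤ N → R s N w = 0)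
    (c : ℕ → ℕ → ℕ → ℂ) (S : ℕ)
    (h : ∀ i j, P i * Q j - Q j * P i = ∑ s ∈ Finset.range S, c s i j • R s (i + j)) (w : W) :
    ∃ B₀ : ℕ, ∀ B, B₀ ≤ B →
      (pointwiseSum P hP * pointwiseSum Q hQ - pointwiseSum Q hQ * pointwiseSum P hP) w =
        ∑ s ∈ Finset.range S, ∑ N ∈ Finset.range B,
          (∑ x ∈ antidiagonal N, c s x.1 x.2) • R s N w := by
  obtain ⟨B₁, h₁⟩ := exists_pointwiseSum_mul_bound P Q hP hQ w
  obtain ⟨B₂, h₂⟩ := exists_pointwiseSum_mul_bound Q P hQ hP w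
  obtain ⟨B₃, h₃⟩ := exists_uniform_bound (fun s N => R s N w = 0) S fun s _ => hR s w
  refine ⟨max (max B₁ B₂) B₃, fun B hB => ?_⟩
  rw [LinearMap.sub_apply, Module.End.mul_apply, Module.End.mul_apply, h₁ B (by omega),
    h₂ B (by omega), Finset.sum_comm (f := fun i j => Q i (P j w)), ← Finset.sum_sub_distrib]
  have h₄ : ∀ i j, P i (Q j w) - Q j (P i w) =
      ∑ s ∈ Finset.range S, c s i j • R s (i + j) w := by
    intro i j
    simpa [LinearMap.sum_apply] using LinearMap.congr_fun (h i j) w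
  simp_rw [← Finset.sum_sub_distrib, h₄]
  have h₅ : ∀ s ∈ Finset.range S, ∑ N ∈ Finset.range B,
      (∑ x ∈ antidiagonal N, c s x.1 x.2) • R s N w =
      ∑ i ∈ Finset.range B, ∑ j ∈ Finset.range B, c s i j • R s (i + j) w := by
    intro s hs
    rw [← sum_range_sum_antidiagonal_eq (fun i j => c s i j • R s (i + j) w)]
    · refine Finset.sum_congr rfl fun N _ => ?_
      rw [Finset.sum_smul]
      refine Finset.sum_congr rfl fun x hx => ?_
      rw [mem_antidiagonal] at hx
      rw [hx]
    · intro i j hij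
      rw [h₃ s (by simpa using hs) _ (by omega), smul_zero]
  rw [Finset.sum_congr rfl h₅, Finset.sum_comm]
  conv_rhs => rw [Finset.sum_comm]
  rw [Finset.sum_comm]
  refine Finset.sum_congr rfl fun i _ => ?_
  rw [Finset.sum_comm]

end PointwiseSum

/-! ### The two delta-function operators -/

namespace VertexOperatorModule

variable {V : Type*} [AddCommGroup V] [Module ℂ V] {A : VertexOperatorAlgebra V}
variable {W : Type*} [AddCommGroup W] [Module ℂ W] (M : VertexOperatorModule A W)

theorem delta_apply_eq_sum (z : ℂ) (v : V) (k m : ℤ) (w : W) (B : ℕ)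
    (hB : ∀ i : ℕ, B ≤ i → vertexMode M.Y v (m + i) w = 0) :
    M.delta z v k m w = ∑ i ∈ Finset.range B,
      ((Ring.choose (k : ℂ) i) * (-z) ^ (k - i)) • vertexMode M.Y v (m + i) w :=
  pointwiseSum_apply_eq_sum _ _ w B fun i hi => by
    rw [LinearMap.smul_apply, hB i hi, smul_zero]

theorem oppDelta_apply_eq_sum (z : ℂ) (v : V) (k m : ℤ) (w : W) (B : ℕ)
    (hB : ∀ i : ℕ, B ≤ i → M.oppMode v (m + k - i) w = 0) :
    M.oppDelta z v k m w = ∑ i ∈ Finset.range B,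
      ((Ring.choose (k : ℂ) i) * (-z) ^ i) • M.oppMode v (m + k - i) w :=
  pointwiseSum_apply_eq_sum _ _ w B fun i hi => by
    rw [LinearMap.smul_apply, hB i hi, smul_zero]

theorem exists_mode_bound (v : V) (m : ℤ) (w : W) :
    ∃ B : ℕ, ∀ i : ℕ, B ≤ i → vertexMode M.Y v (m + i) w = 0 := by
  obtain ⟨N, hN⟩ := vertexMode_truncation M.Y v w
  exact ⟨(N - m).toNat, fun i hi => hN _ (by omega)⟩

theorem exists_oppMode_bound (v : V) (m : ℤ) (w : W) :
    ∃ B : ℕ, ∀ i : ℕ, B ≤ i → M.oppMode v (m - i) w = 0 := by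
  obtain ⟨N, hN⟩ := M.oppMode_truncation v w
  exact ⟨(m - N).toNat, fun i hi => hN _ (by omega)⟩

/-- Here `delta z u k m` is the mode of `u` against `f = x^m (x-z)^k`, expanded in powers of `x`.
The double sum is the Leibniz expansion of `f^(s)/s!`, multiplied by `(x-z)^n`. -/
theorem delta_commutator (z : ℂ) (hz : z ≠ 0) (u v : V) (S : ℕ)
    (hS : ∀ s : ℕ, S ≤ s → vertexMode A.Y u s v = 0) (k m n : ℤ) :
    M.delta z u k m * M.delta z v n 0 - M.delta z v n 0 * M.delta z u k m =
      ∑ s ∈ Finset.range S, ∑ p ∈ antidiagonal s,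
        (Ring.choose (k : ℂ) p.1 * Ring.choose (m : ℂ) p.2) •
          M.delta z (vertexMode A.Y u s v) (k - p.1 + n) (m - p.2) := by
  have hz' : -z ≠ 0 := neg_ne_zero.2 hz
  ext w
  obtain ⟨B₁, h₁⟩ := exists_pointwiseSum_commutator
    (fun i : ℕ => ((Ring.choose (k : ℂ) i) * (-z) ^ (k - i)) • vertexMode M.Y u (m + i))
    (fun i : ℕ => ((Ring.choose (n : ℂ) i) * (-z) ^ (n - i)) • vertexMode M.Y v (0 + i))
    _ _ (fun s N => vertexMode M.Y (vertexMode A.Y u s v) (m - s + N))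
    (fun s w => M.exists_mode_bound _ _ w)
    (fun s i j => (Ring.choose (k : ℂ) i * (-z) ^ (k - i)) *
      (Ring.choose (n : ℂ) j * (-z) ^ (n - j)) * Ring.choose ((m : ℂ) + i) s) S (by
        intro i j
        rw [smul_mul_smul_comm, smul_mul_smul_comm, mul_comm (Ring.choose (n : ℂ) j * _),
          ← smul_sub, vertexMode_commutator M.jacobi _ _ _ _ S hS, Finset.smul_sum]
        refine Finset.sum_congr rfl fun s _ => ?_
        rw [smul_smul]
        congr 2
        · push_cast
          rfl
        · push_cast
          ring) w
  obtain ⟨B₂, h₂⟩ := exists_uniform_bound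
    (fun s N => vertexMode M.Y (vertexMode A.Y u s v) (m - s + N) w = 0) S
    fun s _ => M.exists_mode_bound _ _ w
  set B := max B₁ B₂
  refine (h₁ B (le_max_left _ _)).trans ?_
  simp only [LinearMap.sum_apply, LinearMap.smul_apply]
  refine Finset.sum_congr rfl fun s hs => ?_
  have h₃ : ∀ N : ℕ, B ≤ N → vertexMode M.Y (vertexMode A.Y u s v) (m - s + N) w = 0 :=
    fun N hN => h₂ s (by simpa using hs) N ((le_max_right _ _).trans hN)
  -- With `N = p.1 + r` every `p` contributes to the same modes `m - s + N`, so coefficients can be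
  -- compared.
  have hR : ∀ p ∈ antidiagonal s, M.delta z (vertexMode A.Y u s v) (k - p.1 + n) (m - p.2) w =
      ∑ N ∈ Finset.range B, ((if p.1 ≤ N then
        Ring.choose ((k : ℂ) - p.1 + n) (N - p.1) else 0) * (-z) ^ (k + n - N)) •
          vertexMode M.Y (vertexMode A.Y u s v) (m - s + N) w := by
    intro p hp
    rw [mem_antidiagonal] at hp
    rw [M.delta_apply_eq_sum _ _ _ _ _ B]
    · refine Eq.trans ?_ ((sum_range_shift (fun N => (Ring.choose ((k : ℂ) - p.1 + n) (N - p.1) *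
        (-z) ^ (k + n - N)) • vertexMode M.Y (vertexMode A.Y u s v) (m - s + N) w) p.1 B ?_).trans
          ?_)
      · refine Finset.sum_congr rfl fun r _ => ?_
        rw [Nat.add_sub_cancel]
        congr 3
        · push_cast
          rfl
        · push_cast
          ring
        · rw [← hp]
          push_cast
          ring
      · intro N hN
        rw [h₃ N hN, smul_zero]
      · refine Finset.sum_congr rfl fun N _ => ?_
        split_ifs <;> simp
    · intro i hi
      rw [show m - (p.2 : ℤ) + i = m - s + ((p.1 + i : ℕ) : ℤ) by rw [← hp]; push_cast; ring]
      exact h₃ _ (by omega)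
  refine Eq.trans ?_ (Finset.sum_congr rfl fun p hp => congrArg
    (fun x => (Ring.choose (k : ℂ) p.1 * Ring.choose (m : ℂ) p.2) • x) (hR p hp)).symm
  simp_rw [Finset.smul_sum, smul_smul]
  rw [Finset.sum_comm]
  refine Finset.sum_congr rfl fun N _ => ?_
  rw [← Finset.sum_smul]
  congr 1
  simp_rw [← mul_assoc, ← Finset.sum_mul]
  rw [← sum_choose_mul_choose_add, Finset.sum_mul]
  refine Finset.sum_congr rfl fun x hx => ?_
  rw [mem_antidiagonal] at hx
  -- The exponents may be negative: this is where `z ≠ 0` enters.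
  have : (-z) ^ (k + n - N) = (-z) ^ (k - x.1) * (-z) ^ (n - x.2) := by
    rw [← zpow_add₀ hz', ← hx]
    congr 1
    push_cast
    ring
  rw [this]
  ring

/-- The same Leibniz expansion with `(x-z)^k` in powers of `z`: the exponents of `-z` are natural
numbers, so `z` is unrestricted, and no index shift is needed. The sign is that of
`oppMode_commutator`. -/
theorem oppDelta_commutator (z : ℂ) (u v : V) :
    ∃ S₀ : ℕ, ∀ S, S₀ ≤ S → ∀ k m n : ℤ,
      M.oppDelta z u k m * M.oppDelta z v n 0 - M.oppDelta z v n 0 * M.oppDelta z u k m =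
        -∑ s ∈ Finset.range S, ∑ p ∈ antidiagonal s,
          (Ring.choose (k : ℂ) p.1 * Ring.choose (m : ℂ) p.2) •
            M.oppDelta z (vertexMode A.Y u s v) (k - p.1 + n) (m - p.2) := by
  obtain ⟨S₀, hS₀⟩ := M.oppMode_commutator u v
  refine ⟨S₀, fun S hS k m n => ?_⟩
  ext w
  obtain ⟨B₁, h₁⟩ := exists_pointwiseSum_commutator
    (fun i : ℕ => ((Ring.choose (k : ℂ) i) * (-z) ^ i) • M.oppMode u (m + k - i))
    (fun i : ℕ => ((Ring.choose (n : ℂ) i) * (-z) ^ i) • M.oppMode v (0 + n - i))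
    _ _ (fun s N => M.oppMode (vertexMode A.Y u s v) (m + k + n - s - N))
    (fun s w => M.exists_oppMode_bound _ _ w)
    (fun s i j => -((Ring.choose (k : ℂ) i * (-z) ^ i) *
      (Ring.choose (n : ℂ) j * (-z) ^ j) * Ring.choose ((m : ℂ) + k - i) s)) S (by
        intro i j
        rw [smul_mul_smul_comm, smul_mul_smul_comm, mul_comm (Ring.choose (n : ℂ) j * _),
          ← smul_sub, hS₀ S hS, smul_neg, Finset.smul_sum, ← Finset.sum_neg_distrib]
        refine Finset.sum_congr rfl fun s _ => ?_
        rw [smul_smul, neg_smul]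
        congr 3
        · push_cast
          rfl
        · push_cast
          ring) w
  obtain ⟨B₂, h₂⟩ := exists_uniform_bound
    (fun s N => M.oppMode (vertexMode A.Y u s v) (m + k + n - s - N) w = 0) S
    fun s _ => M.exists_oppMode_bound _ _ w
  set B := max B₁ B₂
  refine (h₁ B (le_max_left _ _)).trans ?_
  simp only [LinearMap.neg_apply, LinearMap.sum_apply, LinearMap.smul_apply]
  rw [← Finset.sum_neg_distrib]
  refine Finset.sum_congr rfl fun s hs => ?_
  have hR : ∀ p ∈ antidiagonal s,
      M.oppDelta z (vertexMode A.Y u s v) (k - p.1 + n) (m - p.2) w =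
      ∑ N ∈ Finset.range B, (Ring.choose ((k : ℂ) - p.1 + n) N * (-z) ^ N) •
          M.oppMode (vertexMode A.Y u s v) (m + k + n - s - N) w := by
    intro p hp
    rw [mem_antidiagonal] at hp
    have hidx : ∀ N : ℕ, m - (p.2 : ℤ) + (k - p.1 + n) - N = m + k + n - s - N := fun N => by
      rw [← hp]
      push_cast
      ring
    rw [M.oppDelta_apply_eq_sum _ _ _ _ _ B]
    · refine Finset.sum_congr rfl fun N _ => ?_
      rw [hidx]
      push_cast
      rfl
    · intro i hi
      rw [hidx]
      exact h₂ s (by simpa using hs) i ((le_max_right _ _).trans hi)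
  refine Eq.trans ?_ (congrArg Neg.neg (Finset.sum_congr rfl fun p hp => congrArg
    (fun x => (Ring.choose (k : ℂ) p.1 * Ring.choose (m : ℂ) p.2) • x) (hR p hp)).symm)
  simp_rw [Finset.smul_sum, smul_smul]
  rw [Finset.sum_comm, ← Finset.sum_neg_distrib]
  refine Finset.sum_congr rfl fun N _ => ?_
  rw [← Finset.sum_smul, ← neg_smul]
  congr 1
  simp_rw [← mul_assoc, ← Finset.sum_mul]
  rw [← sum_choose_mul_choose_sub, Finset.sum_mul, ← Finset.sum_neg_distrib]
  refine Finset.sum_congr rfl fun x hx => ?_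
  rw [mem_antidiagonal] at hx
  rw [← hx, pow_add]
  ring

theorem delta_add (z : ℂ) (u v : V) (k m : ℤ) :
    M.delta z (u + v) k m = M.delta z u k m + M.delta z v k m := by
  ext w
  obtain ⟨B₁, h₁⟩ := M.exists_mode_bound u m w
  obtain ⟨B₂, h₂⟩ := M.exists_mode_bound v m w
  rw [LinearMap.add_apply, M.delta_apply_eq_sum z u k m w (max B₁ B₂) fun i hi => h₁ i (by omega),
    M.delta_apply_eq_sum z v k m w (max B₁ B₂) fun i hi => h₂ i (by omega),
    M.delta_apply_eq_sum z (u + v) k m w (max B₁ B₂) fun i hi => by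
      rw [vertexMode_add, LinearMap.add_apply, h₁ i (by omega), h₂ i (by omega), add_zero],
    ← Finset.sum_add_distrib]
  simp_rw [vertexMode_add, LinearMap.add_apply, smul_add]

theorem delta_smul (z c : ℂ) (v : V) (k m : ℤ) :
    M.delta z (c • v) k m = c • M.delta z v k m := by
  ext w
  obtain ⟨B, hB⟩ := M.exists_mode_bound v m w
  rw [LinearMap.smul_apply, M.delta_apply_eq_sum z v k m w B hB,
    M.delta_apply_eq_sum z (c • v) k m w B fun i hi => by
      rw [vertexMode_smul, LinearMap.smul_apply, hB i hi, smul_zero], Finset.smul_sum]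
  simp_rw [vertexMode_smul, LinearMap.smul_apply, smul_comm c]

theorem oppDelta_add (z : ℂ) (u v : V) (k m : ℤ) :
    M.oppDelta z (u + v) k m = M.oppDelta z u k m + M.oppDelta z v k m := by
  ext w
  obtain ⟨B₁, h₁⟩ := M.exists_oppMode_bound u (m + k) w
  obtain ⟨B₂, h₂⟩ := M.exists_oppMode_bound v (m + k) w
  rw [LinearMap.add_apply,
    M.oppDelta_apply_eq_sum z u k m w (max B₁ B₂) fun i hi => h₁ i (by omega),
    M.oppDelta_apply_eq_sum z v k m w (max B₁ B₂) fun i hi => h₂ i (by omega),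
    M.oppDelta_apply_eq_sum z (u + v) k m w (max B₁ B₂) fun i hi => by
      rw [oppMode_add, LinearMap.add_apply, h₁ i (by omega), h₂ i (by omega), add_zero],
    ← Finset.sum_add_distrib]
  simp_rw [oppMode_add, LinearMap.add_apply, smul_add]

theorem oppDelta_smul (z c : ℂ) (v : V) (k m : ℤ) :
    M.oppDelta z (c • v) k m = c • M.oppDelta z v k m := by
  ext w
  obtain ⟨B, hB⟩ := M.exists_oppMode_bound v (m + k) w
  rw [LinearMap.smul_apply, M.oppDelta_apply_eq_sum z v k m w B hB,
    M.oppDelta_apply_eq_sum z (c • v) k m w B fun i hi => by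
      rw [oppMode_smul, LinearMap.smul_apply, hB i hi, smul_zero], Finset.smul_sum]
  simp_rw [oppMode_smul, LinearMap.smul_apply, smul_comm c]

/-- Integration by parts: the mode of `L(-1)v` against `(x-z)^k` is minus that of `v` against the
derivative. -/
theorem delta_L_neg_one (z : ℂ) (v : V) (k : ℤ) :
    M.delta z (vertexMode A.Y A.conformal 0 v) k 0 = (-(k : ℂ)) • M.delta z v (k - 1) 0 := by
  ext w
  obtain ⟨B, hB⟩ := M.exists_mode_bound v 0 w
  rw [LinearMap.smul_apply, M.delta_apply_eq_sum z v (k - 1) 0 w B hB,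
    M.delta_apply_eq_sum z _ k 0 w (B + 1) fun i hi => ?_, Finset.sum_range_succ', Finset.smul_sum]
  · simp only [M.L_neg_one_derivative, Nat.cast_zero, add_zero, Int.cast_zero, neg_zero, zero_smul,
      LinearMap.zero_apply, smul_zero]
    refine Finset.sum_congr rfl fun i _ => ?_
    rw [LinearMap.smul_apply, smul_smul, smul_smul,
      show (0 : ℤ) + ((i + 1 : ℕ) : ℤ) - 1 = 0 + i by push_cast; ring,
      show k - ((i + 1 : ℕ) : ℤ) = k - 1 - i by push_cast; ring]
    congr 1
    have h := Ring.choose_smul_choose (k : ℂ) (Nat.le_add_left 1 i)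
    rw [Nat.choose_one_right, Ring.choose_one_right, Nat.add_sub_cancel, nsmul_eq_mul] at h
    push_cast at h ⊢
    linear_combination (-(-z) ^ (k - 1 - i)) * h
  · rw [M.L_neg_one_derivative, LinearMap.smul_apply]
    obtain ⟨j, rfl⟩ : ∃ j, i = j + 1 := ⟨i - 1, by omega⟩
    rw [show (0 : ℤ) + ((j + 1 : ℕ) : ℤ) - 1 = 0 + j by push_cast; ring, hB j (by omega),
      smul_zero]

theorem oppDelta_L_neg_one (z : ℂ) (v : V) (k : ℤ) :
    M.oppDelta z (vertexMode A.Y A.conformal 0 v) k 0 = (-(k : ℂ)) • M.oppDelta z v (k - 1) 0 := by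
  ext w
  obtain ⟨B, hB⟩ := M.exists_oppMode_bound v (0 + (k - 1)) w
  rw [LinearMap.smul_apply, M.oppDelta_apply_eq_sum z v (k - 1) 0 w B hB,
    M.oppDelta_apply_eq_sum z _ k 0 w B fun i hi => ?_, Finset.smul_sum]
  · refine Finset.sum_congr rfl fun i _ => ?_
    rw [M.oppMode_L_neg_one, LinearMap.smul_apply, smul_smul, smul_smul,
      show 0 + k - (i : ℤ) - 1 = 0 + (k - 1) - i by ring]
    congr 1
    have h := choose_mul_choose_sub (k : ℂ) i 1
    rw [Ring.choose_one_right, Ring.choose_one_right] at h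
    push_cast at h ⊢
    linear_combination (-(-z) ^ i) * h
  · rw [M.oppMode_L_neg_one, LinearMap.smul_apply,
      show 0 + k - (i : ℤ) - 1 = 0 + (k - 1) - i by ring, hB i hi, smul_zero]

end VertexOperatorModule

/-! ### The action on the dual of the tensor product -/

section Qz

variable {V : Type*} [AddCommGroup V] [Module ℂ V] {A : VertexOperatorAlgebra V}
variable {W₁ : Type*} [AddCommGroup W₁] [Module ℂ W₁] (M₁ : VertexOperatorModule A W₁)
variable {W₂ : Type*} [AddCommGroup W₂] [Module ℂ W₂] (M₂ : VertexOperatorModule A W₂)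

theorem tauQ_apply_tmul (z : ℂ) (v : V) (k m : ℤ) (l : Module.Dual ℂ (W₁ ⊗[ℂ] W₂)) (w₁ : W₁)
    (w₂ : W₂) : tauQ M₁ M₂ z v k m l (w₁ ⊗ₜ w₂) =
      l (M₁.oppDelta z v k m w₁ ⊗ₜ w₂) - l (w₁ ⊗ₜ M₂.delta z v k m w₂) := by
  simp [tauQ]

theorem dual_tensor_ext {l l' : Module.Dual ℂ (W₁ ⊗[ℂ] W₂)}
    (h : ∀ w₁ w₂, l (w₁ ⊗ₜ w₂) = l' (w₁ ⊗ₜ w₂)) : l = l' :=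
  TensorProduct.ext' h

/-- The commutator formula for the action of `τ_{Q(z)}`. -/
theorem tauQ_commutator (z : ℂ) (hz : z ≠ 0) (u v : V) :
    ∃ S₀ : ℕ, ∀ S, S₀ ≤ S → ∀ k m n : ℤ,
      tauQ M₁ M₂ z u k m * YQ M₁ M₂ z v n - YQ M₁ M₂ z v n * tauQ M₁ M₂ z u k m =
        ∑ s ∈ Finset.range S, ∑ p ∈ antidiagonal s,
          (Ring.choose (k : ℂ) p.1 * Ring.choose (m : ℂ) p.2) •
            tauQ M₁ M₂ z (vertexMode A.Y u s v) (k - p.1 + n) (m - p.2) := by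
  obtain ⟨S₁, h₁⟩ := M₁.oppDelta_commutator z u v
  obtain ⟨N, hN⟩ := vertexMode_truncation A.Y u v
  refine ⟨max S₁ N.toNat, fun S hS k m n => ?_⟩
  have h₂ := M₂.delta_commutator z hz u v S (fun s hs => hN s (by omega)) k m n
  refine LinearMap.ext fun l => dual_tensor_ext fun w₁ w₂ => ?_
  have h₃ := congrArg (fun x => l (x ⊗ₜ w₂)) (LinearMap.congr_fun (h₁ S (by omega) k m n) w₁)
  have h₄ := congrArg (fun x => l (w₁ ⊗ₜ x)) (LinearMap.congr_fun h₂ w₂)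
  simp only [LinearMap.sub_apply, LinearMap.neg_apply, Module.End.mul_apply, LinearMap.sum_apply,
    LinearMap.smul_apply, TensorProduct.sub_tmul, TensorProduct.tmul_sub, TensorProduct.neg_tmul,
    TensorProduct.sum_tmul, TensorProduct.tmul_sum, TensorProduct.tmul_smul,
    ← TensorProduct.smul_tmul', map_sub, map_neg, map_sum, map_smul] at h₃ h₄
  simp only [YQ, LinearMap.sub_apply, Module.End.mul_apply, LinearMap.sum_apply,
    LinearMap.smul_apply, tauQ_apply_tmul, smul_sub, Finset.sum_sub_distrib]
  -- Dualizing reverses the order of composition, and the mixed terms, one operator on each tensor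
  -- factor, cancel.
  linear_combination -h₃ - h₄

theorem YQ_commutator (z : ℂ) (hz : z ≠ 0) (u v : V) :
    ∃ S₀ : ℕ, ∀ S, S₀ ≤ S → ∀ k n : ℤ,
      YQ M₁ M₂ z u k * YQ M₁ M₂ z v n - YQ M₁ M₂ z v n * YQ M₁ M₂ z u k =
        ∑ s ∈ Finset.range S, Ring.choose (k : ℂ) s •
          YQ M₁ M₂ z (vertexMode A.Y u s v) (k + n - s) := by
  obtain ⟨S₀, hS₀⟩ := tauQ_commutator M₁ M₂ z hz u v
  refine ⟨S₀, fun S hS k n => (hS₀ S hS k 0 n).trans (Finset.sum_congr rfl fun s _ => ?_)⟩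
  -- For `m = 0` the factor `choose 0 p.2` leaves only `p.2 = 0`.
  rw [Finset.sum_eq_single (s, 0)]
  · simp only [Int.cast_zero, Ring.choose_zero_right, mul_one, Nat.cast_zero, sub_zero, YQ]
    rw [sub_add_eq_add_sub]
  · rintro ⟨a, b⟩ hp hne
    have hb : b ≠ 0 := by
      rintro rfl
      rw [mem_antidiagonal] at hp
      exact hne (by simpa using hp)
    simp [Ring.choose_zero_ite, hb]
  · intro h
    exact absurd (by simp) h

theorem YQ_add (z : ℂ) (u v : V) (n : ℤ) :
    YQ M₁ M₂ z (u + v) n = YQ M₁ M₂ z u n + YQ M₁ M₂ z v n := by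
  refine LinearMap.ext fun l => dual_tensor_ext fun w₁ w₂ => ?_
  simp only [YQ, LinearMap.add_apply, tauQ_apply_tmul, VertexOperatorModule.oppDelta_add,
    VertexOperatorModule.delta_add, TensorProduct.add_tmul, TensorProduct.tmul_add, map_add]
  ring

theorem YQ_smul (z c : ℂ) (v : V) (n : ℤ) : YQ M₁ M₂ z (c • v) n = c • YQ M₁ M₂ z v n := by
  refine LinearMap.ext fun l => dual_tensor_ext fun w₁ w₂ => ?_
  simp only [YQ, LinearMap.smul_apply, tauQ_apply_tmul, VertexOperatorModule.oppDelta_smul,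
    VertexOperatorModule.delta_smul, TensorProduct.tmul_smul, ← TensorProduct.smul_tmul',
    map_smul, smul_sub]

theorem YQ_zero_left (z : ℂ) (n : ℤ) : YQ M₁ M₂ z (0 : V) n = 0 := by
  simpa using YQ_smul M₁ M₂ z 0 (0 : V) n

/-- The `L(-1)`-derivative property of `Y'_{Q(z)}`. -/
theorem YQ_L_neg_one (z : ℂ) (v : V) (n : ℤ) :
    YQ M₁ M₂ z (vertexMode A.Y A.conformal 0 v) n = (-(n : ℂ)) • YQ M₁ M₂ z v (n - 1) := by
  refine LinearMap.ext fun l => dual_tensor_ext fun w₁ w₂ => ?_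
  simp only [YQ, LinearMap.smul_apply, tauQ_apply_tmul, VertexOperatorModule.oppDelta_L_neg_one,
    VertexOperatorModule.delta_L_neg_one, TensorProduct.tmul_smul, ← TensorProduct.smul_tmul',
    map_smul, smul_sub]

/-- Since `choose 1 s = 0` for `s ≥ 2`, only `L(-1)v` and `L(0)v` enter the commutator; it shows
that `v_n` shifts weights by `h - n - 1`. -/
theorem YQ_conformal_one_YQ (z : ℂ) (hz : z ≠ 0) {h : ℤ} {v : V} (hv : v ∈ A.grade h) (n : ℤ)
    (l : Module.Dual ℂ (W₁ ⊗[ℂ] W₂)) :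
    YQ M₁ M₂ z A.conformal 1 (YQ M₁ M₂ z v n l) =
      ((h : ℂ) - n - 1) • YQ M₁ M₂ z v n l +
        YQ M₁ M₂ z v n (YQ M₁ M₂ z A.conformal 1 l) := by
  obtain ⟨S, hS⟩ := YQ_commutator M₁ M₂ z hz A.conformal v
  have h₁ := LinearMap.congr_fun (hS (S + 2) (by omega) 1 n) l
  rw [← Finset.sum_subset (Finset.range_mono (Nat.le_add_left 2 S))] at h₁
  · rw [Finset.sum_range_succ, Finset.sum_range_one] at h₁
    simp only [LinearMap.sub_apply, Module.End.mul_apply, LinearMap.add_apply,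
      LinearMap.smul_apply, Nat.cast_zero, Nat.cast_one, Ring.choose_zero_right,
      Ring.choose_one_right, Int.cast_one, one_smul, YQ_L_neg_one, A.L_zero h v hv,
      YQ_smul] at h₁
    rw [sub_eq_iff_eq_add] at h₁
    rw [h₁, show (1 : ℤ) + n - 0 - 1 = n by ring, show (1 : ℤ) + n - 1 = n by ring]
    push_cast
    module
  · intro s _ hs
    have : Ring.choose ((1 : ℤ) : ℂ) s = 0 := by
      have := Ring.choose_natCast (R := ℂ) 1 s
      rw [Nat.choose_eq_zero_of_lt (by simpa using hs)] at this
      simpa using this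
    rw [this, zero_smul]

/-! ### The compatibility condition -/

section Compatibility

variable {M₁ M₂} {z : ℂ} {l l' : Module.Dual ℂ (W₁ ⊗[ℂ] W₂)}

theorem LowerTruncationCondition.exists_bound (h : LowerTruncationCondition M₁ M₂ z l) (v : V)
    (k : ℤ) : ∃ B : ℕ, ∀ i : ℕ, B ≤ i → YQ M₁ M₂ z v (k + i) l = 0 := by
  obtain ⟨N, hN⟩ := h v
  exact ⟨(N - k).toNat, fun i hi => hN _ (by omega)⟩

theorem finsum_YQ_eq_sum (v : V) (k m : ℤ) (B : ℕ)
    (hB : ∀ i : ℕ, B ≤ i → YQ M₁ M₂ z v (k + i) l = 0) :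
    ∑ᶠ i : ℕ, ((Ring.choose (m : ℂ) i) * z ^ (m - i)) • YQ M₁ M₂ z v (k + i) l =
      ∑ i ∈ Finset.range B,
        ((Ring.choose (m : ℂ) i) * z ^ (m - i)) • YQ M₁ M₂ z v (k + i) l := by
  refine finsum_eq_sum_of_support_subset _ fun i hi => ?_
  by_contra hlt
  exact hi (by
    beta_reduce
    rw [hB i (by simpa using hlt), smul_zero])

theorem CompatibilityCondition.zero : CompatibilityCondition M₁ M₂ z 0 :=
  ⟨fun _ => ⟨0, fun _ _ => map_zero _⟩, fun v k m => by simp⟩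

theorem CompatibilityCondition.add (h : CompatibilityCondition M₁ M₂ z l)
    (h' : CompatibilityCondition M₁ M₂ z l') : CompatibilityCondition M₁ M₂ z (l + l') := by
  refine ⟨fun v => ?_, fun v k m => ?_⟩
  · obtain ⟨N, hN⟩ := h.1 v
    obtain ⟨N', hN'⟩ := h'.1 v
    exact ⟨max N N', fun n hn => by
      rw [map_add, hN n (by omega), hN' n (by omega), add_zero]⟩
  · obtain ⟨B, hB⟩ := h.1.exists_bound v k
    obtain ⟨B', hB'⟩ := h'.1.exists_bound v k
    rw [map_add, h.2, h'.2, finsum_YQ_eq_sum v k m (max B B') fun i hi => hB i (by omega),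
      finsum_YQ_eq_sum v k m (max B B') fun i hi => hB' i (by omega),
      finsum_YQ_eq_sum v k m (max B B') fun i hi => by
        rw [map_add, hB i (by omega), hB' i (by omega), add_zero], ← Finset.sum_add_distrib]
    simp_rw [map_add, smul_add]

theorem CompatibilityCondition.smul (c : ℂ) (h : CompatibilityCondition M₁ M₂ z l) :
    CompatibilityCondition M₁ M₂ z (c • l) := by
  refine ⟨fun v => ?_, fun v k m => ?_⟩
  · obtain ⟨N, hN⟩ := h.1 v
    exact ⟨N, fun n hn => by rw [map_smul, hN n hn, smul_zero]⟩
  · obtain ⟨B, hB⟩ := h.1.exists_bound v k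
    rw [map_smul, h.2, finsum_YQ_eq_sum v k m B hB, finsum_YQ_eq_sum v k m B fun i hi => by
        rw [map_smul, hB i hi, smul_zero], Finset.smul_sum]
    simp_rw [map_smul, smul_comm c]

/-- Modulo the commutator `u_k` acts on `l` itself, and the commutator involves finitely many
vectors `u_s v`, all truncated on `l`. -/
theorem LowerTruncationCondition.YQ (hz : z ≠ 0) (h : LowerTruncationCondition M₁ M₂ z l)
    (v : V) (n : ℤ) : LowerTruncationCondition M₁ M₂ z (YQ M₁ M₂ z v n l) := by
  intro u
  obtain ⟨S, hS⟩ := YQ_commutator M₁ M₂ z hz u v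
  obtain ⟨N, hN⟩ := h u
  obtain ⟨B, hB⟩ := exists_uniform_bound
    (fun s i => _root_.YQ M₁ M₂ z (vertexMode A.Y u s v) (n - s + i) l = 0) S
    fun s _ => h.exists_bound _ _
  refine ⟨max N B, fun k hk => ?_⟩
  have h₁ := LinearMap.congr_fun (hS S le_rfl k n) l
  rw [LinearMap.sub_apply, Module.End.mul_apply, Module.End.mul_apply, hN k (by omega), map_zero,
    sub_zero] at h₁
  rw [h₁, LinearMap.sum_apply]
  refine Finset.sum_eq_zero fun s hs => ?_
  have := hB s (by simpa using hs) k.toNat (by omega)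
  rw [show n - s + (k.toNat : ℤ) = k + n - s by omega] at this
  rw [LinearMap.smul_apply, this, smul_zero]

/-- Expanding `(z+t)^m` in powers of `t` commutes with differentiation, so compatibility of `l` for
each `u_s v` matches the corrections produced by commuting `v_n` past both sides. -/
theorem CompatibilityCondition.YQ (hz : z ≠ 0) (h : CompatibilityCondition M₁ M₂ z l)
    (v : V) (n : ℤ) : CompatibilityCondition M₁ M₂ z (YQ M₁ M₂ z v n l) := by
  refine ⟨h.1.YQ hz v n, fun u k m => ?_⟩
  obtain ⟨S₁, hS₁⟩ := tauQ_commutator M₁ M₂ z hz u v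
  obtain ⟨S₂, hS₂⟩ := YQ_commutator M₁ M₂ z hz u v
  set S := max S₁ S₂
  obtain ⟨B₁, hB₁⟩ := (h.1.YQ hz v n).exists_bound u k
  obtain ⟨B₂, hB₂⟩ := h.1.exists_bound u k
  obtain ⟨B₃, hB₃⟩ := exists_uniform_bound
    (fun s i => _root_.YQ M₁ M₂ z (vertexMode A.Y u s v) (k + n - s + i) l = 0) S
    fun s _ => h.1.exists_bound _ _
  set B := max (max B₁ B₂) B₃
  have hcomm : ∀ i : ℕ, _root_.YQ M₁ M₂ z u (k + i) (_root_.YQ M₁ M₂ z v n l) =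
      _root_.YQ M₁ M₂ z v n (_root_.YQ M₁ M₂ z u (k + i) l) +
        ∑ s ∈ Finset.range S, Ring.choose ((k : ℂ) + i) s •
          _root_.YQ M₁ M₂ z (vertexMode A.Y u s v) (k + n - s + i) l := by
    intro i
    have h₁ := LinearMap.congr_fun (hS₂ S (le_max_right _ _) (k + i) n) l
    rw [LinearMap.sub_apply, Module.End.mul_apply, Module.End.mul_apply, sub_eq_iff_eq_add',
      LinearMap.sum_apply] at h₁
    rw [h₁]
    congr 1
    refine Finset.sum_congr rfl fun s _ => ?_
    rw [LinearMap.smul_apply, show k + (i : ℤ) + n - s = k + n - s + i by ring]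
    push_cast
    rfl
  have htau := LinearMap.congr_fun (hS₁ S (le_max_left _ _) k m n) l
  rw [LinearMap.sub_apply, Module.End.mul_apply, Module.End.mul_apply, sub_eq_iff_eq_add',
    LinearMap.sum_apply] at htau
  rw [htau, finsum_YQ_eq_sum u k m B fun i hi => hB₁ i (by omega), h.2 u k m,
    finsum_YQ_eq_sum u k m B fun i hi => hB₂ i (by omega)]
  simp_rw [hcomm, smul_add, Finset.sum_add_distrib, map_sum, map_smul, Finset.smul_sum]
  congr 1
  rw [Finset.sum_comm (s := Finset.range B)]
  refine Finset.sum_congr rfl fun s hs => ?_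
  have hB₃' : ∀ i : ℕ, B ≤ i →
      _root_.YQ M₁ M₂ z (vertexMode A.Y u s v) (k + n - s + i) l = 0 :=
    fun i hi => hB₃ s (by simpa using hs) i (by omega)
  have hterm : ∀ p ∈ antidiagonal s,
      tauQ M₁ M₂ z (vertexMode A.Y u s v) (k - p.1 + n) (m - p.2) l =
        ∑ N ∈ Finset.range B, ((if p.2 ≤ N then Ring.choose ((m : ℂ) - p.2) (N - p.2) else 0) *
          z ^ (m - N)) • _root_.YQ M₁ M₂ z (vertexMode A.Y u s v) (k + n - s + N) l := by
    intro p hp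
    rw [mem_antidiagonal] at hp
    have hidx : ∀ r : ℕ, k - (p.1 : ℤ) + n + r = k + n - s + (r + p.2 : ℕ) := fun r => by
      rw [← hp]
      push_cast
      ring
    rw [h.2, finsum_YQ_eq_sum _ _ _ B fun i hi => by
      rw [hidx]
      exact hB₃' _ (by omega)]
    refine Eq.trans ?_ ((sum_range_shift (fun N => (Ring.choose ((m : ℂ) - p.2) (N - p.2) *
      z ^ (m - N)) • _root_.YQ M₁ M₂ z (vertexMode A.Y u s v) (k + n - s + N) l) p.2 B ?_).trans
        ?_)
    · refine Finset.sum_congr rfl fun r _ => ?_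
      rw [Nat.add_sub_cancel, hidx, show m - (p.2 : ℤ) - r = m - (r + p.2 : ℕ) by
        push_cast; ring]
      push_cast
      rfl
    · intro N hN
      rw [hB₃' N hN, smul_zero]
    · refine Finset.sum_congr rfl fun N _ => ?_
      split_ifs <;> simp
  rw [LinearMap.sum_apply]
  refine (Finset.sum_congr rfl fun p hp => congrArg
    (fun x => (Ring.choose (k : ℂ) p.1 * Ring.choose (m : ℂ) p.2) • x) (hterm p hp)).trans ?_
  simp_rw [Finset.smul_sum, smul_smul]
  rw [Finset.sum_comm]
  refine Finset.sum_congr rfl fun N _ => ?_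
  -- Here `m` and `k` exchange roles in the identity, hence the swap of the antidiagonal.
  rw [← Finset.sum_smul, mul_right_comm, choose_mul_choose_add,
    ← Finset.Nat.sum_antidiagonal_swap, Finset.sum_mul]
  congr 1
  refine Finset.sum_congr rfl fun p _ => ?_
  simp only [Prod.fst_swap, Prod.snd_swap]
  ring

end Compatibility

end Qz

/-! ### Invariant subspaces and eigenspaces -/

section Eigenspaces

variable {K E : Type*} [Field K] [AddCommGroup E] [Module K E] {f : Module.End K E}

/-- Applying `f - ν` kills the `ν` term and multiplies each other one by `μ - ν ≠ 0`, which gives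
the induction. -/
theorem Submodule.mem_of_sum_eigenvectors_mem {p : Submodule K E} (hp : ∀ x ∈ p, f x ∈ p)
    (s : Finset K) : ∀ x : K → E, (∀ μ, x μ ∈ f.eigenspace μ) → ∑ μ ∈ s, x μ ∈ p →
      ∀ μ ∈ s, x μ ∈ p := by
  classical
  induction s using Finset.induction_on with
  | empty => simp
  | insert ν s hν ih =>
    intro x hx hsum
    have hs : ∀ μ ∈ s, x μ ∈ p := by
      intro μ hμ
      have h₁ : ∑ μ ∈ s, (μ - ν) • x μ ∈ p := by
        have h₂ := p.sub_mem (hp _ hsum) (p.smul_mem ν hsum)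
        convert h₂ using 1
        rw [map_sum, Finset.smul_sum, ← Finset.sum_sub_distrib, Finset.sum_insert hν,
          Module.End.mem_eigenspace_iff.1 (hx ν), sub_self, zero_add]
        refine Finset.sum_congr rfl fun μ _ => ?_
        rw [Module.End.mem_eigenspace_iff.1 (hx μ), sub_smul]
      have h₃ := ih (fun μ => (μ - ν) • x μ) (fun μ => Submodule.smul_mem _ _ (hx μ)) h₁ μ hμ
      have hne : μ - ν ≠ 0 := sub_ne_zero.2 fun h => hν (h ▸ hμ)
      exact (p.smul_mem_iff hne).1 h₃
    intro μ hμ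
    rcases Finset.mem_insert.1 hμ with rfl | hμ
    · rw [Finset.sum_insert hν] at hsum
      exact (p.add_mem_iff_left (p.sum_mem hs)).1 hsum
    · exact hs μ hμ

/-- An invariant subspace of a sum of eigenspaces is the sum of its own eigenspaces. -/
theorem Submodule.iSup_inf_eigenspace_eq {p : Submodule K E} (hp : ∀ x ∈ p, f x ∈ p)
    (hle : p ≤ ⨆ μ, f.eigenspace μ) : ⨆ μ, p ⊓ f.eigenspace μ = p := by
  refine le_antisymm (iSup_le fun μ => inf_le_left) fun x hx => ?_
  obtain ⟨y, hy, rfl⟩ := (Submodule.mem_iSup_iff_exists_finsupp _ _).1 (hle hx)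
  have := Submodule.mem_of_sum_eigenvectors_mem hp y.support y hy hx
  exact Submodule.sum_mem _ fun μ hμ =>
    Submodule.mem_iSup_of_mem μ ⟨this μ hμ, hy μ⟩

/-- Intersection does not distribute over sums in general; here `p` and `q` split into their own
eigenspaces, and eigenspaces are independent. -/
theorem Submodule.sup_inf_eigenspace_eq {p q : Submodule K E} (hp : ∀ x ∈ p, f x ∈ p)
    (hple : p ≤ ⨆ μ, f.eigenspace μ) (hq : ∀ x ∈ q, f x ∈ q) (hqle : q ≤ ⨆ μ, f.eigenspace μ)
    (μ : K) : (p ⊔ q) ⊓ f.eigenspace μ = (p ⊓ f.eigenspace μ) ⊔ (q ⊓ f.eigenspace μ) := by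
  set C : K → Submodule K E := fun μ => (p ⊓ f.eigenspace μ) ⊔ (q ⊓ f.eigenspace μ)
  have hC : ∀ μ, C μ ≤ f.eigenspace μ := fun μ => sup_le inf_le_right inf_le_right
  have hsup : p ⊔ q ≤ C μ ⊔ ⨆ ν, ⨆ (_ : ν ≠ μ), f.eigenspace ν := by
    have h₁ : p ⊔ q = ⨆ ν, C ν := by
      rw [iSup_sup_eq, Submodule.iSup_inf_eigenspace_eq hp hple,
        Submodule.iSup_inf_eigenspace_eq hq hqle]
    rw [h₁]
    refine iSup_le fun ν => ?_
    by_cases h : ν = μ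
    · subst h
      exact le_sup_left
    · exact ((hC ν).trans (le_iSup₂_of_le ν h le_rfl)).trans le_sup_right
  refine le_antisymm ?_ (sup_le (inf_le_inf_right _ le_sup_left) (inf_le_inf_right _ le_sup_right))
  refine (inf_le_inf_right _ hsup).trans ?_
  -- The modular law applies because `C μ` lies in the `μ`-eigenspace; independence removes the
  -- rest.
  rw [sup_inf_assoc_of_le _ (hC μ), inf_comm,
    (Module.End.eigenspaces_iSupIndep f μ).eq_bot, sup_bot_eq]

end Eigenspaces

/-! ### Weights and the local grading-restriction condition -/

section Qz

variable {V : Type*} [AddCommGroup V] [Module ℂ V] {A : VertexOperatorAlgebra V}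
variable {W₁ : Type*} [AddCommGroup W₁] [Module ℂ W₁] (M₁ : VertexOperatorModule A W₁)
variable {W₂ : Type*} [AddCommGroup W₂] [Module ℂ W₂] (M₂ : VertexOperatorModule A W₂)

theorem YQ_mem_iSup_weightSpaceQ (z : ℂ) (hz : z ≠ 0) (v : V) (n : ℤ)
    (l : Module.Dual ℂ (W₁ ⊗[ℂ] W₂)) (hl : l ∈ ⨆ n : ℂ, weightSpaceQ M₁ M₂ z n) :
    YQ M₁ M₂ z v n l ∈ ⨆ n : ℂ, weightSpaceQ M₁ M₂ z n := by
  induction v using A.homogeneous_induction with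
  | zero => simp [YQ_zero_left]
  | add u v hu hv =>
    rw [YQ_add]
    exact Submodule.add_mem _ hu hv
  | hom h v hv =>
    refine Submodule.iSup_induction _
      (motive := fun l => YQ M₁ M₂ z v n l ∈ ⨆ n : ℂ, weightSpaceQ M₁ M₂ z n) hl ?_ ?_ ?_
    · intro r x hx
      refine Submodule.mem_iSup_of_mem ((h : ℂ) - n - 1 + r) ?_
      have hx' : YQ M₁ M₂ z A.conformal 1 x = r • x := Module.End.mem_eigenspace_iff.1 hx
      refine Module.End.mem_eigenspace_iff.2 ?_
      rw [YQ_conformal_one_YQ M₁ M₂ z hz hv, hx', map_smul, ← add_smul]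
    · simp
    · intro x y hx hy
      rw [map_add]
      exact Submodule.add_mem _ hx hy

theorem mem_generatedQ_self (z : ℂ) (l : Module.Dual ℂ (W₁ ⊗[ℂ] W₂)) :
    l ∈ generatedQ M₁ M₂ z l :=
  Submodule.mem_sInf.2 fun _ hS => hS.1

theorem YQ_mem_generatedQ (z : ℂ) (l : Module.Dual ℂ (W₁ ⊗[ℂ] W₂)) (v : V) (n : ℤ)
    (μ : Module.Dual ℂ (W₁ ⊗[ℂ] W₂)) (hμ : μ ∈ generatedQ M₁ M₂ z l) :
    YQ M₁ M₂ z v n μ ∈ generatedQ M₁ M₂ z l :=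
  Submodule.mem_sInf.2 fun S hS => hS.2 v n μ (Submodule.mem_sInf.1 hμ S hS)

theorem generatedQ_le (z : ℂ) {l : Module.Dual ℂ (W₁ ⊗[ℂ] W₂)}
    {S : Submodule ℂ (Module.Dual ℂ (W₁ ⊗[ℂ] W₂))} (hl : l ∈ S)
    (hS : ∀ (v : V) (n : ℤ), ∀ μ ∈ S, YQ M₁ M₂ z v n μ ∈ S) : generatedQ M₁ M₂ z l ≤ S :=
  sInf_le ⟨hl, hS⟩

theorem generatedQ_le_iSup_weightSpaceQ (z : ℂ) (hz : z ≠ 0) {l : Module.Dual ℂ (W₁ ⊗[ℂ] W₂)}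
    (hl : l ∈ ⨆ n : ℂ, weightSpaceQ M₁ M₂ z n) :
    generatedQ M₁ M₂ z l ≤ ⨆ n : ℂ, weightSpaceQ M₁ M₂ z n :=
  generatedQ_le M₁ M₂ z hl fun v n μ hμ => YQ_mem_iSup_weightSpaceQ M₁ M₂ z hz v n μ hμ

section LocalGradingRestriction

variable {M₁ M₂} {z : ℂ} {l l' : Module.Dual ℂ (W₁ ⊗[ℂ] W₂)}

/-- Minimality gives `W_l' ≤ W_l`, and both restrictions pass to subspaces. This covers scalar
multiples and stability under the action at once. -/
theorem LocalGradingRestrictionCondition.of_mem_generatedQ (hz : z ≠ 0)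
    (h : LocalGradingRestrictionCondition M₁ M₂ z l) (hl' : l' ∈ generatedQ M₁ M₂ z l) :
    LocalGradingRestrictionCondition M₁ M₂ z l' := by
  have hle : generatedQ M₁ M₂ z l' ≤ generatedQ M₁ M₂ z l :=
    generatedQ_le M₁ M₂ z hl' (YQ_mem_generatedQ M₁ M₂ z l)
  obtain ⟨h₁, h₂, N, hN⟩ := h
  refine ⟨generatedQ_le_iSup_weightSpaceQ M₁ M₂ z hz h₁ hl', fun n => ?_, N, fun n hn => ?_⟩
  · have := h₂ n
    exact Submodule.finiteDimensional_of_le (inf_le_inf_right _ hle)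
  · exact eq_bot_iff.2 ((inf_le_inf_right _ hle).trans (hN n hn).le)

theorem LocalGradingRestrictionCondition.zero : LocalGradingRestrictionCondition M₁ M₂ z 0 := by
  have h : generatedQ M₁ M₂ z 0 = ⊥ :=
    eq_bot_iff.2 (generatedQ_le M₁ M₂ z (Submodule.zero_mem _) fun v n μ hμ => by
      rw [(Submodule.mem_bot ℂ).1 hμ, map_zero]
      exact Submodule.zero_mem _)
  refine ⟨Submodule.zero_mem _, fun n => ?_, 0, fun n _ => ?_⟩
  · rw [h, bot_inf_eq]
    infer_instance
  · rw [h, bot_inf_eq]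

/-- The stable subspace `W_l + W_l'` contains `W_(l+l')`, and its weight spaces are sums of theirs.
-/
theorem LocalGradingRestrictionCondition.add (hz : z ≠ 0)
    (h : LocalGradingRestrictionCondition M₁ M₂ z l)
    (h' : LocalGradingRestrictionCondition M₁ M₂ z l') :
    LocalGradingRestrictionCondition M₁ M₂ z (l + l') := by
  obtain ⟨h₁, h₂, N, hN⟩ := h
  obtain ⟨h₁', h₂', N', hN'⟩ := h'
  have hle : generatedQ M₁ M₂ z (l + l') ≤ generatedQ M₁ M₂ z l ⊔ generatedQ M₁ M₂ z l' := by
    refine generatedQ_le M₁ M₂ z (Submodule.add_mem_sup (mem_generatedQ_self M₁ M₂ z l)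
      (mem_generatedQ_self M₁ M₂ z l')) fun v n μ hμ => ?_
    obtain ⟨x, hx, y, hy, rfl⟩ := Submodule.mem_sup.1 hμ
    rw [map_add]
    exact Submodule.add_mem_sup (YQ_mem_generatedQ M₁ M₂ z l v n x hx)
      (YQ_mem_generatedQ M₁ M₂ z l' v n y hy)
  have hwt : ∀ n : ℂ, generatedQ M₁ M₂ z (l + l') ⊓ weightSpaceQ M₁ M₂ z n ≤
      (generatedQ M₁ M₂ z l ⊓ weightSpaceQ M₁ M₂ z n) ⊔
        (generatedQ M₁ M₂ z l' ⊓ weightSpaceQ M₁ M₂ z n) := fun n =>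
    (inf_le_inf_right _ hle).trans (Submodule.sup_inf_eigenspace_eq
      (YQ_mem_generatedQ M₁ M₂ z l _ _) (generatedQ_le_iSup_weightSpaceQ M₁ M₂ z hz h₁)
      (YQ_mem_generatedQ M₁ M₂ z l' _ _) (generatedQ_le_iSup_weightSpaceQ M₁ M₂ z hz h₁') n).le
  refine ⟨Submodule.add_mem _ h₁ h₁', fun n => ?_, min N N', fun n hn => ?_⟩
  · have := h₂ n
    have := h₂' n
    exact Submodule.finiteDimensional_of_le (hwt n)
  · refine eq_bot_iff.2 ((hwt n).trans ?_)
    rw [hN n (hn.trans_le (min_le_left _ _)), hN' n (hn.trans_le (min_le_right _ _)), sup_bot_eq]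

end LocalGradingRestriction

end Qz

theorem proposition6p2 {V W₁ W₂ : Type*} [AddCommGroup V] [Module ℂ V]
    [AddCommGroup W₁] [Module ℂ W₁] [AddCommGroup W₂] [Module ℂ W₂]
    (A : VertexOperatorAlgebra V) (M₁ : VertexOperatorModule A W₁) (M₂ : VertexOperatorModule A W₂)
    (z : ℂ) (hz : z ≠ 0) :
    (∃ S : Submodule ℂ (Module.Dual ℂ (W₁ ⊗[ℂ] W₂)),
      (∀ l, l ∈ S ↔ CompatibilityCondition M₁ M₂ z l) ∧
        ∀ (v : V) (n : ℤ), ∀ l ∈ S, YQ M₁ M₂ z v n l ∈ S) ∧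
    (∃ S : Submodule ℂ (Module.Dual ℂ (W₁ ⊗[ℂ] W₂)),
      (∀ l, l ∈ S ↔ LocalGradingRestrictionCondition M₁ M₂ z l) ∧
        ∀ (v : V) (n : ℤ), ∀ l ∈ S, YQ M₁ M₂ z v n l ∈ S) := by
  refine ⟨⟨{ carrier := {l | CompatibilityCondition M₁ M₂ z l}
             add_mem' := fun h h' => h.add h'
             zero_mem' := CompatibilityCondition.zero
             smul_mem' := fun c _ h => h.smul c }, fun _ => Iff.rfl, fun v n l h => h.YQ hz v n⟩,
    ⟨{ carrier := {l | LocalGradingRestrictionCondition M₁ M₂ z l}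
       add_mem' := fun h h' => h.add hz h'
       zero_mem' := LocalGradingRestrictionCondition.zero
       smul_mem' := fun c l h => h.of_mem_generatedQ hz
        (Submodule.smul_mem _ c (mem_generatedQ_self M₁ M₂ z l)) },
      fun _ => Iff.rfl, fun v n l h => h.of_mem_generatedQ hz
        (YQ_mem_generatedQ M₁ M₂ z l v n l (mem_generatedQ_self M₁ M₂ z l))⟩⟩
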